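/- Let $G$ be a finite weakly connected directed graph with vertex set $V$ and arc set $A\subseteq V\times V$, and let $B\in\{-1,0,1\}^{V\times A}$ be its incidence matrix ($B_{v,a}=1$ if $a$ leaves $v$, $-1$ if $a$ enters $v$, and $0$ otherwise; loops give zero columns). Let $T\ge 1$ be an integer and let $l,u\in\mathbb R^{A}$ with $l_a<u_a$ for all $a\in A$ (a PESP instance on $G$; arc weights play no role). An oriented cycle is a vector $\gamma\in\{-1,0,1\}^A$ with $B\gamma=0$; the cycle space is the subgroup of $\mathbb Z^A$ generated by the oriented cycles, and $\mu$ is its rank. Let $\gamma_1,\dots,\gamma_\mu$ be an integral cycle basis, i.e. $\mu$ oriented cycles generating the cycle space over $\mathbb Z$, and let $\Gamma\in\mathbb Z^{\mu\times A}$ be the matrix with rows $\gamma_1,\dots,\gamma_\mu$. Let $\Gamma'$ arise from $\Gamma$ by scaling the column of each arc $a$ by $(u_a-l_a)/T$. Put $$X_{LP}=\{x\in\mathbb R^A\mid l\le x\le u\},\qquad Z=\{z\in\mathbb R^\mu\mid \exists x\in X_{LP}\colon \Gamma x=Tz\},$$ and, for a vertex $i\in V$, let $P_i=X_{LP}+\operatorname{pos}(\widehat{B^\top}_i)$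 be the Minkowski sum of $X_{LP}$ and the convex cone generated by the columns of $B^\top$ other than the $i$-th. For a real matrix $M$ with $\mu$ rows and $b\in\mathbb R^\mu$ let $Z(M,b)=\{Mx\mid \mathbf 0\le x\le\mathbf 1\}+b$, and let $M_S$ denote $M$ with the columns indexed by $S$ deleted. A zonotopal tiling of a zonotope $Z(M,b)$ is a finite family of nonempty polytopes (cells) with union $Z(M,b)$, closed under taking nonempty faces, such that any two cells with nonempty intersection meet in a common face, and such that each cell is a translate of some $Z(M_S,\mathbf 0)$. Its tiles are the inclusion-maximal cells; it is fine if every tile is a translate of some $Z(M_S,\mathbf 0)$ such that the columns of $M_S$ are linearly independent (so every tile is a parallelotope). All faces are understood to be nonempty. Theorem. Let $i\in V$. 1. Every bounded face of $P_i$ is a face of $X_{LP}$. 2. The image of every $k$-dimensional bounded face of $P_i$ under $\frac1T\Gamma$ is a $k$-dimensional parallelotope, and distinct bounded faces have distinct images. 3. $Z$ is a translate of $Z(\Gamma',\mathbf 0)$, and the images under $\frac1T\Gamma$ of the bounded faces of $P_i$ are exactly the cells of a fine zonotopal tiling of $Z$ (with respect to $\Gamma'$). 4. The tiles of this tiling are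 exactly the images of the $\mu$-dimensional bounded faces of $P_i$. -/

import Mathlib

open scoped Pointwise

noncomputable section

/-! ### Faces, parallelotopes, zonotopes and their tilings -/

namespace Zono

/-- `F` is a (nonempty) face of `P`: the set of points of `P` at which some linear functional
attains its maximum over `P`. -/
def IsFace {E : Type*} [AddCommGroup E] [Module ℝ E] [TopologicalSpace E] (P F : Set E) : Prop :=
  F.Nonempty ∧ IsExposed ℝ P F

/-- The dimension of (the affine hull of) a set. -/
def dim {E : Type*} [AddCommGroup E] [Module ℝ E] (F : Set E) : ℕ :=
  Module.finrank ℝ (vectorSpan ℝ F)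

/-- `C` is a `k`-dimensional parallelotope: a translate of
`{∑ t_j g_j | 0 ≤ t ≤ 1}` for linearly independent `g_1, …, g_k`. -/
def IsParallelotope {E : Type*} [AddCommGroup E] [Module ℝ E] (k : ℕ) (C : Set E) : Prop :=
  ∃ (b : E) (g : Fin k → E), LinearIndependent ℝ g ∧ C = b +ᵥ parallelepiped g

/-- The zonotope `Z(A, b) = {A x | 0 ≤ x ≤ 1} + b`. -/
def zonotope {m n : Type*} [Fintype n] (A : Matrix m n ℝ) (b : m → ℝ) : Set (m → ℝ) :=
  {z | ∃ x : n → ℝ, (∀ j, 0 ≤ x j ∧ x j ≤ 1) ∧ z = A.mulVec x + b}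

/-- The submatrix `A_S` obtained from `A` by deleting the columns indexed by `S`. -/
def deleteCols {m n : Type*} (A : Matrix m n ℝ) (S : Finset n) : Matrix m {j // j ∉ S} ℝ :=
  A.submatrix id Subtype.val

/-- `𝒞` is (the set of nonempty cells of) a polyhedral subdivision of `Z` into polytopes:
a finite polyhedral complex with union `Z`. -/
structure IsPolyhedralSubdivision {E : Type*} [AddCommGroup E] [Module ℝ E] [TopologicalSpace E]
    (Z : Set E) (𝒞 : Set (Set E)) : Prop where
  finite : 𝒞.Finite
  polytope : ∀ C ∈ 𝒞, ∃ s : Set E, s.Finite ∧ s.Nonempty ∧ C = convexHull ℝ s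
  face_mem : ∀ C ∈ 𝒞, ∀ F, IsFace C F → F ∈ 𝒞
  inter : ∀ C ∈ 𝒞, ∀ D ∈ 𝒞, (C ∩ D).Nonempty → IsFace C (C ∩ D) ∧ IsFace D (C ∩ D)
  union : ⋃₀ 𝒞 = Z

/-- A tile of a subdivision is a maximal cell. -/
def IsTile {E : Type*} (𝒞 : Set (Set E)) (C : Set E) : Prop :=
  Maximal (· ∈ 𝒞) C

/-- `𝒞` is a zonotopal tiling of `Z`, where `Z` is a translate of the zonotope `Z(A)`: a polyhedral
subdivision of `Z` whose cells are translates of zonotopes `Z(A_S)`. -/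
structure IsZonotopalTiling {m n : Type*} [Fintype n] [DecidableEq n]
    (A : Matrix m n ℝ) (Z : Set (m → ℝ)) (𝒞 : Set (Set (m → ℝ))) : Prop where
  isZonotope : ∃ b, Z = zonotope A b
  subdivision : IsPolyhedralSubdivision Z 𝒞
  cells : ∀ C ∈ 𝒞, ∃ (S : Finset n) (b : m → ℝ), C = zonotope (deleteCols A S) b

/-- A zonotopal tiling is fine if every tile is a parallelotope, i.e. a translate of a `Z(A_S)`
whose generators are linearly independent. -/
structure IsFineZonotopalTiling {m n : Type*} [Fintype n] [DecidableEq n]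
    (A : Matrix m n ℝ) (Z : Set (m → ℝ)) (𝒞 : Set (Set (m → ℝ))) : Prop
    extends IsZonotopalTiling A Z 𝒞 where
  fine : ∀ C, IsTile 𝒞 C → ∃ (S : Finset n) (b : m → ℝ),
    C = zonotope (deleteCols A S) b ∧ LinearIndependent ℝ (deleteCols A S).col

end Zono

/-! ### Digraphs, cycle bases -/

namespace PESP

/-- The arcs of a digraph. -/
abbrev Arc {V : Type*} (G : Digraph V) : Type _ := {a : V × V // G.Adj a.1 a.2}

/-- Weak connectedness: the underlying undirected graph is connected. -/
def WeaklyConnected {V : Type*} (G : Digraph V) : Prop :=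
  G.toSimpleGraphInclusive.Connected

/-- The incidence matrix `B`: the entry at vertex `v` and arc `a` is `1` if `a` leaves `v`,
`-1` if `a` enters `v`, and `0` otherwise. -/
def incidence (R : Type*) [Ring R] {V : Type*} [DecidableEq V] (G : Digraph V) :
    Matrix V (Arc G) R :=
  fun v a => (if a.1.1 = v then 1 else 0) - (if a.1.2 = v then 1 else 0)

variable {V : Type*} [Fintype V] [DecidableEq V] (G : Digraph V) [DecidableRel G.Adj]

/-- An oriented cycle: a vector `γ ∈ {-1, 0, 1}^A` with `B γ = 0`. -/
def IsOrientedCycle (γ : Arc G → ℤ) : Prop :=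
  (∀ a, γ a = -1 ∨ γ a = 0 ∨ γ a = 1) ∧ (incidence ℤ G).mulVec γ = 0

/-- The cycle space: the subgroup of `ℤ^A` generated by the oriented cycles. -/
def cycleSpace : Submodule ℤ (Arc G → ℤ) :=
  Submodule.span ℤ {γ | IsOrientedCycle G γ}

/-- The cyclomatic number `μ`: the rank of the cycle space. -/
def cyclomaticNumber : ℕ := Module.finrank ℤ (cycleSpace G)

/-- An integral cycle basis: a `μ`-tuple of oriented cycles generating the cycle space over `ℤ`. -/
structure IntegralCycleBasis where
  γ : Fin (cyclomaticNumber G) → Arc G → ℤ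
  isOrientedCycle : ∀ k, IsOrientedCycle G (γ k)
  generates : Submodule.span ℤ (Set.range γ) = cycleSpace G

/-- The data of a PESP instance on `G`: a period `T`, arc bounds `l`, `u` and weights `w`. -/
structure Instance where
  T : ℕ
  T_pos : 0 < T
  l : Arc G → ℝ
  u : Arc G → ℝ
  w : Arc G → ℝ

variable {G}

/-- The cycle matrix `Γ` (as a real matrix), whose rows are the cycles of the basis. -/
def IntegralCycleBasis.cycleMatrix (𝓑 : IntegralCycleBasis G) :
    Matrix (Fin (cyclomaticNumber G)) (Arc G) ℝ :=
  fun k a => (𝓑.γ k a : ℝ)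

/-- `X_LP = {x ∈ ℝ^A | l ≤ x ≤ u}`. -/
def Instance.XLP (I : Instance G) : Set (Arc G → ℝ) := {x | I.l ≤ x ∧ x ≤ I.u}

/-- `P_i = X_LP + pos(columns of Bᵀ other than the `i`-th)`, a Minkowski sum. -/
def Instance.P (I : Instance G) (i : V) : Set (Arc G → ℝ) :=
  I.XLP + (PointedCone.hull ℝ {c | ∃ j, j ≠ i ∧ c = (incidence ℝ G).transpose.col j} :
    Set (Arc G → ℝ))

/-- The set of bounded faces of `P_i`. -/
def Instance.boundedFaces (I : Instance G) (i : V) : Set (Set (Arc G → ℝ)) :=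
  {F | Zono.IsFace (I.P i) F ∧ Bornology.IsBounded F}

/-- The cycle offset zonotope `Z = {z | ∃ x, Γ x = T z, l ≤ x ≤ u}`. -/
def Instance.Z (I : Instance G) (𝓑 : IntegralCycleBasis G) :
    Set (Fin (cyclomaticNumber G) → ℝ) :=
  {z | ∃ x : Arc G → ℝ, 𝓑.cycleMatrix.mulVec x = (I.T : ℝ) • z ∧ I.l ≤ x ∧ x ≤ I.u}

/-- The matrix `Γ'`: the column of `Γ` at the arc `a` scaled by `(u_a - l_a) / T`. -/
def Instance.scaledCycleMatrix (I : Instance G) (𝓑 : IntegralCycleBasis G) :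
    Matrix (Fin (cyclomaticNumber G)) (Arc G) ℝ :=
  fun k a => (I.u a - I.l a) / (I.T : ℝ) * 𝓑.cycleMatrix k a

/-- The linear map `x ↦ Γ x / T`. -/
def Instance.proj (I : Instance G) (𝓑 : IntegralCycleBasis G) (x : Arc G → ℝ) :
    Fin (cyclomaticNumber G) → ℝ :=
  (1 / (I.T : ℝ)) • 𝓑.cycleMatrix.mulVec x

end PESP

end

/-! A functional `c` exposes a bounded face of `P_i` exactly when its excess `(Bc)_j` is negative at
every vertex `j ≠ i` (`NegativeOff`). The cone then adds nothing to the maximisers, so the face is a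
face of the box (`mem_boundedFaces_iff`).

The fibres of `Γ` are the translates of the space of potential differences `grad π`, where one may
normalise `π i = 0`. A point `x` of a bounded face is the lowest point of its fibre: if `x + grad π`
also lies in the box, then `π ≥ 0`, because otherwise adding the gradient of `min(π, 0)` would
increase `c` within the box (`potential_nonneg`). Hence the projection is injective on the union of
all bounded faces (`injOn_projₗ`). Conversely, minimising over a fibre a functional with excess `1`
off `i` gives a point on a bounded face, so the images cover `Z` (`exists_mem_boxFace_of_mem_Icc`).

Functionals that factor through `Γ` have zero excess, so adding them to `c` preserves `NegativeOff`.
A small multiple yields the faces of a cell (`exists_of_isFace_image`); a multiple that makes a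
coefficient vanish enlarges a cell of dimension below `μ` (`exists_dim_lt`). Cells meet in common
faces because `d` restricted to the face of `c` descends, up to a constant, to the image
(`isFace_image_inter`). -/

noncomputable section

namespace Zono

/-! ### Faces of a box and the functionals exposing them -/

section Box

variable {A : Type*}

/-- The face of the box `[l, u]` at which the linear functional with coefficients `c` is
maximal. -/
def boxFace (l u c : A → ℝ) : Set (A → ℝ) :=
  {x | ∀ a, l a ≤ x a ∧ x a ≤ u a ∧ (0 < c a → x a = u a) ∧ (c a < 0 → x a = l a)}

lemma boxFace_subset_Icc (l u c : A → ℝ) : boxFace l u c ⊆ Set.Icc l u :=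
  fun _ hx => ⟨fun a => (hx a).1, fun a => (hx a).2.1⟩

/-- The vertex of `boxFace l u c` which is lowest in the free coordinates. -/
def lowVertex (l u c : A → ℝ) (a : A) : ℝ := if 0 < c a then u a else l a

/-- The vertex of `boxFace l u c` which is highest in the free coordinates. -/
def highVertex (l u c : A → ℝ) (a : A) : ℝ := if c a < 0 then l a else u a

lemma lowVertex_mem {l u : A → ℝ} (h : l ≤ u) (c : A → ℝ) : lowVertex l u c ∈ boxFace l u c := by
  intro a
  have := h a
  unfold lowVertex
  split_ifs with h1
  · exact ⟨this, le_rfl, fun _ => rfl, fun h2 => absurd h1 h2.not_gt⟩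
  · exact ⟨le_rfl, this, fun h2 => absurd h2 h1, fun _ => rfl⟩

lemma highVertex_mem {l u : A → ℝ} (h : l ≤ u) (c : A → ℝ) :
    highVertex l u c ∈ boxFace l u c := by
  intro a
  have := h a
  unfold highVertex
  split_ifs with h1
  · exact ⟨le_rfl, this, fun h2 => absurd h1 h2.not_gt, fun _ => rfl⟩
  · exact ⟨this, le_rfl, fun _ => rfl, fun h2 => absurd h2 h1⟩

lemma lowVertex_le_highVertex {l u : A → ℝ} (h : l ≤ u) (c : A → ℝ) :
    lowVertex l u c ≤ highVertex l u c := by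
  intro a
  have := h a
  unfold lowVertex highVertex
  split_ifs <;> linarith

/-- Since a face of a box is again a box, statements about boxes can be applied to faces of faces.
-/
lemma boxFace_eq_Icc {l u : A → ℝ} (h : l ≤ u) (c : A → ℝ) :
    boxFace l u c = Set.Icc (lowVertex l u c) (highVertex l u c) := by
  ext x
  simp only [Set.mem_Icc, Pi.le_def, ← forall_and]
  refine forall_congr' fun a => ?_
  have := h a
  unfold lowVertex highVertex
  rcases lt_trichotomy (c a) 0 with hc | hc | hc
  · simp only [hc, hc.not_gt, if_true, if_false, false_imp_iff, true_imp_iff]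
    constructor
    · rintro ⟨h1, h2, -, h3⟩; exact ⟨h1, h3.le⟩
    · rintro ⟨h1, h2⟩; exact ⟨h1, h2.trans this, trivial, le_antisymm h2 h1⟩
  · simp [hc]
  · simp only [hc, hc.not_gt, if_true, if_false, false_imp_iff, true_imp_iff]
    constructor
    · rintro ⟨h1, h2, h3, -⟩; exact ⟨h3.ge, h2⟩
    · rintro ⟨h1, h2⟩; exact ⟨this.trans h1, h2, le_antisymm h2 h1, trivial⟩

variable [Fintype A]

lemma isMaxOn_of_mem_boxFace {l u c x y : A → ℝ} (hx : x ∈ boxFace l u c) (hy : y ∈ Set.Icc l u) :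
    c ⬝ᵥ y ≤ c ⬝ᵥ x := by
  refine Finset.sum_le_sum fun a _ => ?_
  obtain ⟨-, -, h1, h2⟩ := hx a
  rcases lt_trichotomy (c a) 0 with hc | hc | hc
  · rw [h2 hc]; exact mul_le_mul_of_nonpos_left (hy.1 a) hc.le
  · simp [hc]
  · rw [h1 hc]; exact mul_le_mul_of_nonneg_left (hy.2 a) hc.le

lemma mem_boxFace_of_isMaxOn {l u : A → ℝ} (h : l ≤ u) {c x : A → ℝ} (hx : x ∈ Set.Icc l u)
    (hmax : ∀ y ∈ Set.Icc l u, c ⬝ᵥ y ≤ c ⬝ᵥ x) : x ∈ boxFace l u c := by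
  classical
  -- The box is a product, so maximality can be tested by changing a single coordinate.
  have key : ∀ a t, l a ≤ t → t ≤ u a → c a * t ≤ c a * x a := by
    intro a t h1 h2
    have hmem : Function.update x a t ∈ Set.Icc l u := by
      constructor <;> intro b <;> by_cases hb : b = a
      · subst hb; simpa
      · simpa [hb] using hx.1 b
      · subst hb; simpa
      · simpa [hb] using hx.2 b
    have := hmax _ hmem
    have e : Function.update x a t = x + Pi.single a (t - x a) := by
      ext b
      by_cases hb : b = a
      · subst hb; simp
      · simp [hb]
    rw [e, dotProduct_add, dotProduct_single] at this
    linarith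
  intro a
  refine ⟨hx.1 a, hx.2 a, fun hc => ?_, fun hc => ?_⟩
  · exact le_antisymm (hx.2 a) ((mul_le_mul_iff_right₀ hc).1 (key a _ (h a) le_rfl))
  · exact le_antisymm ((mul_le_mul_left_of_neg hc).1 (key a _ le_rfl (h a))) (hx.1 a)

lemma boxFace_eq_argmax {l u : A → ℝ} (h : l ≤ u) (c : A → ℝ) :
    boxFace l u c = {x ∈ Set.Icc l u | ∀ y ∈ Set.Icc l u, c ⬝ᵥ y ≤ c ⬝ᵥ x} :=
  Set.Subset.antisymm
    (fun _ hx => ⟨boxFace_subset_Icc _ _ _ hx, fun _ hy => isMaxOn_of_mem_boxFace hx hy⟩)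
    fun _ hx => mem_boxFace_of_isMaxOn h hx.1 hx.2

/-- Finitely many strict inequalities survive small perturbations. This serves both for perturbing
functionals and for finding step lengths inside a box. -/
lemma exists_pos_add_smul_sign (c e : A → ℝ) :
    ∃ ε : ℝ, 0 < ε ∧ ∀ a, (0 < c a → 0 < c a + ε * e a) ∧ (c a < 0 → c a + ε * e a < 0) := by
  have : ∀ᶠ ε : ℝ in nhdsWithin 0 (Set.Ioi 0),
      ∀ a, (0 < c a → 0 < c a + ε * e a) ∧ (c a < 0 → c a + ε * e a < 0) := by
    refine Filter.eventually_all.2 fun a => ?_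
    have ht : Filter.Tendsto (fun ε : ℝ => c a + ε * e a) (nhdsWithin 0 (Set.Ioi 0))
        (nhds (c a)) := by
      have : Continuous fun ε : ℝ => c a + ε * e a := by fun_prop
      simpa using (this.tendsto 0).mono_left nhdsWithin_le_nhds
    refine Filter.Eventually.and ?_ ?_
    · by_cases hc : 0 < c a
      · filter_upwards [ht.eventually (lt_mem_nhds hc)] with ε hε _ using hε
      · simp [hc]
    · by_cases hc : c a < 0
      · filter_upwards [ht.eventually (gt_mem_nhds hc)] with ε hε _ using hε
      · simp [hc]
  obtain ⟨ε, h1, h2⟩ := (this.and self_mem_nhdsWithin).exists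
  exact ⟨ε, h2, h1⟩

/-- A face of a face of a box is a face, exposed by a small perturbation. -/
lemma exists_argmax_boxFace_eq {l u : A → ℝ} (h : l ≤ u) (c e : A → ℝ) :
    ∃ ε : ℝ, 0 < ε ∧ {x ∈ boxFace l u c | ∀ y ∈ boxFace l u c, e ⬝ᵥ y ≤ e ⬝ᵥ x} =
      boxFace l u (c + ε • e) := by
  obtain ⟨ε, hε, hs⟩ := exists_pos_add_smul_sign c e
  refine ⟨ε, hε, ?_⟩
  rw [boxFace_eq_Icc h c, ← boxFace_eq_argmax (lowVertex_le_highVertex h c) e]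
  ext x
  refine forall_congr' fun a => ?_
  have hle := h a
  simp only [lowVertex, highVertex, Pi.add_apply, Pi.smul_apply, smul_eq_mul]
  rcases lt_trichotomy (c a) 0 with hc | hc | hc
  · have := (hs a).2 hc
    simp only [hc, hc.not_gt, this, this.not_gt, if_true, if_false, false_imp_iff, true_imp_iff]
    constructor
    · rintro ⟨h1, h2, -, -⟩; exact ⟨h1, h2.trans hle, trivial, le_antisymm h2 h1⟩
    · rintro ⟨h1, -, -, h2⟩; exact ⟨h1, h2.le, fun _ => h2, fun _ => h2⟩
  · simp [hc, mul_pos_iff_of_pos_left hε, mul_neg_iff, hε, hε.not_gt]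
  · have := (hs a).1 hc
    simp only [hc, hc.not_gt, this, this.not_gt, if_true, if_false, false_imp_iff, true_imp_iff]
    constructor
    · rintro ⟨h1, h2, -, -⟩; exact ⟨hle.trans h1, h2, le_antisymm h2 h1, trivial⟩
    · rintro ⟨-, h1, h2, -⟩; exact ⟨h2.ge, h1, fun _ => h2, fun _ => h2⟩

/-- Only the sign vector of the functional matters. -/
lemma finite_range_boxFace (l u : A → ℝ) : (Set.range (boxFace l u)).Finite := by
  classical
  have : Set.range (boxFace l u) ⊆
      Set.range fun s : A → SignType => boxFace l u fun a => ((s a : ℤ) : ℝ) := by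
    rintro _ ⟨c, rfl⟩
    refine ⟨fun a => SignType.sign (c a), ?_⟩
    ext x
    refine forall_congr' fun a => ?_
    rcases lt_trichotomy (c a) 0 with hc | hc | hc <;> simp [hc, hc.not_gt]
  exact (Set.finite_range _).subset this

/-- The coordinates which are constant on `boxFace l u c`. -/
def fixedCoords (c : A → ℝ) : Finset A := by
  classical exact Finset.univ.filter fun a => c a ≠ 0

lemma mem_fixedCoords {c : A → ℝ} {a : A} : a ∈ fixedCoords c ↔ c a ≠ 0 := by
  simp [fixedCoords]

lemma notMem_fixedCoords {c : A → ℝ} {a : A} : a ∉ fixedCoords c ↔ c a = 0 := by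
  simp [fixedCoords]

variable [DecidableEq A]

/-- The generators are the edges of the box in the free coordinates, starting at the lowest vertex
of the face. -/
lemma boxFace_eq_vadd_parallelepiped {l u : A → ℝ} (h : ∀ a, l a < u a) (c : A → ℝ) :
    boxFace l u c = lowVertex l u c +ᵥ
      parallelepiped fun a : {a // a ∉ fixedCoords c} =>
        Pi.single (M := fun _ => ℝ) a.1 (u a.1 - l a.1) := by
  have hsum : ∀ t : {a // a ∉ fixedCoords c} → ℝ, ∀ b,
      (∑ a, t a • Pi.single (M := fun _ => ℝ) a.1 (u a.1 - l a.1)) b =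
        if hb : b ∉ fixedCoords c then t ⟨b, hb⟩ * (u b - l b) else 0 := by
    intro t b
    rw [Finset.sum_apply]
    by_cases hb : b ∉ fixedCoords c
    · rw [dif_pos hb, Finset.sum_eq_single ⟨b, hb⟩]
      · simp
      · rintro ⟨a, ha⟩ - hne
        have : b ≠ a := fun h => hne (Subtype.ext h.symm)
        simp [this]
      · simp
    · rw [dif_neg hb]
      refine Finset.sum_eq_zero ?_
      rintro ⟨a, ha⟩ -
      have : b ≠ a := fun h => hb (h ▸ ha)
      simp [this]
  ext x
  rw [Set.mem_vadd_set]
  constructor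
  · intro hx
    refine ⟨x - lowVertex l u c, ?_, by simp⟩
    refine (mem_parallelepiped_iff _ _).2 ⟨fun a => (x a.1 - l a.1) / (u a.1 - l a.1), ?_, ?_⟩
    · constructor <;> intro a
      · exact div_nonneg (sub_nonneg.2 (hx a).1) (sub_pos.2 (h a)).le
      · exact (div_le_one (sub_pos.2 (h a))).2 (sub_le_sub_right (hx a).2.1 _)
    · ext b
      rw [hsum]
      by_cases hb : b ∉ fixedCoords c
      · rw [dif_pos hb]
        have h1 := notMem_fixedCoords.1 hb
        have h2 := (sub_pos.2 (h b)).ne'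
        simp [lowVertex, h1]
        field_simp
      · rw [dif_neg hb]
        have h1 := mem_fixedCoords.1 (not_not.1 hb)
        rcases lt_or_gt_of_ne h1 with hc | hc
        · simp [lowVertex, hc.not_gt, (hx b).2.2.2 hc]
        · simp [lowVertex, hc, (hx b).2.2.1 hc]
  · rintro ⟨y, hy, rfl⟩
    obtain ⟨t, ht, rfl⟩ := (mem_parallelepiped_iff _ _).1 hy
    intro b
    have hb' := h b
    simp only [vadd_eq_add, Pi.add_apply]
    rw [hsum]
    by_cases hb : b ∉ fixedCoords c
    · rw [dif_pos hb]
      have h1 := notMem_fixedCoords.1 hb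
      have h2 : 0 ≤ t ⟨b, hb⟩ := ht.1 ⟨b, hb⟩
      have h3 : t ⟨b, hb⟩ ≤ 1 := ht.2 ⟨b, hb⟩
      simp only [lowVertex, h1, lt_irrefl, if_false, false_imp_iff, and_true]
      constructor <;> nlinarith
    · rw [dif_neg hb]
      simpa using lowVertex_mem (fun a => (h a).le) c b

lemma image_vadd_parallelepiped {ι E F : Type*} [Fintype ι] [AddCommGroup E] [Module ℝ E]
    [AddCommGroup F] [Module ℝ F] (f : E →ₗ[ℝ] F) (b : E) (g : ι → E) :
    f '' (b +ᵥ parallelepiped g) = f b +ᵥ parallelepiped (f ∘ g) := by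
  rw [← image_parallelepiped, ← Set.image_vadd, ← Set.image_vadd, Set.image_image, Set.image_image]
  simp

lemma image_boxFace {l u : A → ℝ} (h : ∀ a, l a < u a) (c : A → ℝ) {F : Type*}
    [AddCommGroup F] [Module ℝ F] (f : (A → ℝ) →ₗ[ℝ] F) :
    f '' boxFace l u c = f (lowVertex l u c) +ᵥ
      parallelepiped fun a : {a // a ∉ fixedCoords c} => (u a.1 - l a.1) • f (Pi.single a.1 1) := by
  rw [boxFace_eq_vadd_parallelepiped h, image_vadd_parallelepiped]
  congr 2
  ext1 a
  simp only [Function.comp_apply]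
  rw [← map_smul, ← Pi.single_smul, smul_eq_mul, mul_one]

end Box

/-! ### Parallelotopes and zonotopes -/

section Parallelotope

variable {ι E : Type*} [Fintype ι] [AddCommGroup E] [Module ℝ E]

lemma sum_mem_parallelepiped (g : ι → E) (s : Finset ι) : ∑ i ∈ s, g i ∈ parallelepiped g := by
  classical
  refine (mem_parallelepiped_iff _ _).2 ⟨fun i => if i ∈ s then 1 else 0, ?_, ?_⟩
  · constructor <;> intro i <;> dsimp only <;> split_ifs <;> simp
  · simp [ite_smul]

lemma vectorSpan_vadd_parallelepiped (b : E) (g : ι → E) :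
    vectorSpan ℝ (b +ᵥ parallelepiped g) = Submodule.span ℝ (Set.range g) := by
  rw [vectorSpan_vadd]
  apply le_antisymm
  · rw [vectorSpan_def, Submodule.span_le]
    have key : ∀ x ∈ parallelepiped g, x ∈ Submodule.span ℝ (Set.range g) := by
      intro x hx
      obtain ⟨t, -, rfl⟩ := (mem_parallelepiped_iff _ _).1 hx
      exact Submodule.sum_mem _ fun i _ => Submodule.smul_mem _ _ (Submodule.subset_span ⟨i, rfl⟩)
    rintro _ ⟨x, hx, y, hy, rfl⟩
    exact Submodule.sub_mem _ (key x hx) (key y hy)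
  · rw [Submodule.span_le]
    rintro _ ⟨i, rfl⟩
    have h1 := sum_mem_parallelepiped g {i}
    have h0 := sum_mem_parallelepiped g ∅
    simpa using vsub_mem_vectorSpan ℝ h1 h0

lemma dim_vadd_parallelepiped (b : E) {g : ι → E} (hg : LinearIndependent ℝ g) :
    dim (b +ᵥ parallelepiped g) = Fintype.card ι := by
  rw [dim, vectorSpan_vadd_parallelepiped, finrank_span_eq_card hg]

lemma isParallelotope_vadd_parallelepiped (b : E) {g : ι → E} (hg : LinearIndependent ℝ g) :
    IsParallelotope (Fintype.card ι) (b +ᵥ parallelepiped g) :=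
  ⟨b, g ∘ (Fintype.equivFin ι).symm, hg.comp _ (Equiv.injective _), by
    rw [parallelepiped_comp_equiv]⟩

lemma exists_eq_convexHull_vadd_parallelepiped (b : E) (g : ι → E) :
    ∃ s : Set E, s.Finite ∧ s.Nonempty ∧ b +ᵥ parallelepiped g = convexHull ℝ s := by
  refine ⟨b +ᵥ ∑ i, ({0, g i} : Set E), ?_, ?_, ?_⟩
  · refine Set.Finite.vadd_set ?_
    induction (Finset.univ : Finset ι) using Finset.cons_induction with
    | empty => simp
    | cons i s hi ih =>
      rw [Finset.sum_cons]
      exact Set.Finite.add (by simp) ih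
  · refine Set.Nonempty.vadd_set ?_
    induction (Finset.univ : Finset ι) using Finset.cons_induction with
    | empty => simp
    | cons i s hi ih =>
      rw [Finset.sum_cons]
      exact Set.Nonempty.add (by simp) ih
  · rw [parallelepiped_eq_convexHull, convexHull_vadd]

lemma zonotope_deleteCols {m n : Type*} [Fintype n] [DecidableEq n] (M : Matrix m n ℝ)
    (S : Finset n) (b : m → ℝ) :
    zonotope (deleteCols M S) b = b +ᵥ parallelepiped (deleteCols M S).col := by
  ext z
  rw [Set.mem_vadd_set]
  constructor
  · rintro ⟨x, hx, rfl⟩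
    refine ⟨_, (mem_parallelepiped_iff _ _).2 ⟨x, ⟨fun j => (hx j).1, fun j => (hx j).2⟩, rfl⟩, ?_⟩
    ext k
    simp [Matrix.mulVec, dotProduct, Matrix.col, add_comm, mul_comm]
  · rintro ⟨y, hy, rfl⟩
    obtain ⟨t, ht, rfl⟩ := (mem_parallelepiped_iff _ _).1 hy
    refine ⟨t, fun j => ⟨ht.1 j, ht.2 j⟩, ?_⟩
    ext k
    simp [Matrix.mulVec, dotProduct, Matrix.col, add_comm, mul_comm]

end Parallelotope

/-- The faces exposed by linear functionals on `A → ℝ`. -/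
lemma isFace_iff_dotProduct {A : Type*} [Fintype A] [DecidableEq A] {P F : Set (A → ℝ)} :
    IsFace P F ↔
      F.Nonempty ∧ ∃ c : A → ℝ, F = {x ∈ P | ∀ y ∈ P, c ⬝ᵥ y ≤ c ⬝ᵥ x} := by
  refine and_congr_right fun hne => ⟨fun h => ?_, ?_⟩
  · obtain ⟨L, hL⟩ := h hne
    have : ∀ x, L x = (fun a => L (Pi.single a 1)) ⬝ᵥ x := by
      intro x
      conv_lhs => rw [pi_eq_sum_univ' x]
      simp [dotProduct, mul_comm]
    refine ⟨fun a => L (Pi.single a 1), ?_⟩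
    simpa only [← this] using hL
  · rintro ⟨c, hc⟩ -
    exact ⟨LinearMap.toContinuousLinearMap (dotProductBilin ℝ ℝ c), by simpa using hc⟩

end Zono

namespace PESP

open Zono

/-! ### Potentials, flows and excesses on the digraph -/

section Incidence

variable {V : Type*} {G : Digraph V}

/-- The potential differences `π_v - π_w` along the arcs `(v, w)`. -/
def grad (G : Digraph V) (π : V → ℝ) (a : Arc G) : ℝ := π a.1.1 - π a.1.2

@[simp] lemma grad_add (π ρ : V → ℝ) : grad G (π + ρ) = grad G π + grad G ρ := by
  ext a; simp [grad]; ring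

@[simp] lemma grad_smul (t : ℝ) (π : V → ℝ) : grad G (t • π) = t • grad G π := by
  ext a; simp [grad]; ring

variable [Fintype V] [DecidableEq V] [DecidableRel G.Adj]

lemma incidence_mulVec_single (R : Type*) [Ring R] (a : Arc G) :
    (incidence R G).mulVec (Pi.single a 1) = Pi.single a.1.1 1 - Pi.single a.1.2 1 := by
  ext v
  simp [incidence, Pi.single_apply, eq_comm]

lemma dotProduct_grad (c : Arc G → ℝ) (π : V → ℝ) :
    c ⬝ᵥ grad G π = ∑ j, π j * (incidence ℝ G).mulVec c j := by
  have h : grad G π = Matrix.vecMul π (incidence ℝ G) := by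
    ext a
    simp [grad, Matrix.vecMul, dotProduct, incidence, mul_sub]
  rw [h, dotProduct_comm, ← Matrix.dotProduct_mulVec]
  rfl

lemma incidence_mulVec_apply (c : Arc G → ℝ) (j : V) :
    (incidence ℝ G).mulVec c j = c ⬝ᵥ grad G (Pi.single j 1) := by
  rw [dotProduct_grad]
  simp [Pi.single_apply]

lemma incidence_mulVec_intCast (γ : Arc G → ℤ) (j : V) :
    (incidence ℝ G).mulVec (fun a => (γ a : ℝ)) j = ((incidence ℤ G).mulVec γ j : ℤ) := by
  simp [Matrix.mulVec, dotProduct, incidence]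

lemma IsOrientedCycle.dotProduct_grad {γ : Arc G → ℤ} (h : IsOrientedCycle G γ) (π : V → ℝ) :
    (fun a => (γ a : ℝ)) ⬝ᵥ grad G π = 0 := by
  rw [PESP.dotProduct_grad]
  simp [incidence_mulVec_intCast, h.2]

/-- A path whose edges come from arcs in `E` is the support of a flow of value `1` with entries in
`{-1, 0, 1}`. -/
lemma exists_flow_of_isPath {H : SimpleGraph V} {E : Set (Arc G)}
    (hH : ∀ v w, H.Adj v w → ∃ a ∈ E, a.1 = (v, w) ∨ a.1 = (w, v)) {v w : V} (p : H.Walk v w)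
    (hp : p.IsPath) :
    ∃ c : Arc G → ℤ, (∀ a, c a = -1 ∨ c a = 0 ∨ c a = 1) ∧
      (∀ a, c a ≠ 0 → a ∈ E ∧ a.1.1 ∈ p.support ∧ a.1.2 ∈ p.support) ∧
      (incidence ℤ G).mulVec c = Pi.single v 1 - Pi.single w 1 := by
  induction p with
  | nil => exact ⟨0, by simp, by simp, by simp⟩
  | @cons u v w h p ih =>
    rw [SimpleGraph.Walk.cons_isPath_iff] at hp
    obtain ⟨c, h1, h2, h3⟩ := ih hp.1
    obtain ⟨a, haE, ha⟩ := hH _ _ h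
    have hv : v ∈ p.support := p.start_mem_support
    -- The path does not return to `u`, so the flow built so far avoids `a` and the entries stay in
    -- `{-1, 0, 1}`.
    have hca : c a = 0 := by
      by_contra hne
      obtain ⟨-, h4, h5⟩ := h2 a hne
      rcases ha with ha | ha <;> rw [ha] at h4 h5
      · exact hp.2 h4
      · exact hp.2 h5
    have key : ∀ s : ℤ, (s = -1 ∨ s = 1) →
        s • (incidence ℤ G).mulVec (Pi.single a 1) = Pi.single u 1 - Pi.single v 1 →
        ∃ c : Arc G → ℤ, (∀ a, c a = -1 ∨ c a = 0 ∨ c a = 1) ∧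
        (∀ a, c a ≠ 0 → a ∈ E ∧ a.1.1 ∈ (SimpleGraph.Walk.cons h p).support ∧
          a.1.2 ∈ (SimpleGraph.Walk.cons h p).support) ∧
        (incidence ℤ G).mulVec c = Pi.single u 1 - Pi.single w 1 := by
      intro s hs hinc
      refine ⟨s • Pi.single a 1 + c, fun b => ?_, fun b hb => ?_, ?_⟩
      · by_cases hba : b = a
        · subst hba; simp [hca]; tauto
        · simpa [hba] using h1 b
      · by_cases hba : b = a
        · subst hba
          refine ⟨haE, ?_⟩
          rcases ha with ha | ha <;> simp [ha, hv]
        · obtain ⟨h4, h5, h6⟩ := h2 b (by simpa [hba] using hb)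
          exact ⟨h4, by simp [h5], by simp [h6]⟩
      · rw [Matrix.mulVec_add, Matrix.mulVec_smul, hinc, h3]
        abel
    rcases ha with ha | ha
    · exact key 1 (Or.inr rfl) (by rw [incidence_mulVec_single, ha]; simp)
    · exact key (-1) (Or.inl rfl) (by rw [incidence_mulVec_single, ha]; simp)

/-- A vector orthogonal to all oriented cycles is a vector of potential differences. -/
lemma exists_eq_grad_of_orthogonal (y : Arc G → ℝ)
    (hy : ∀ γ, IsOrientedCycle G γ → (fun a => (γ a : ℝ)) ⬝ᵥ y = 0) : ∃ π, y = grad G π := by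
  -- Induction on the size of the support of `y`: subtracting a suitable gradient makes it smaller.
  induction hn : (fixedCoords y).card using Nat.strong_induction_on generalizing y with
  | _ n ih =>
    subst hn
    by_cases h0 : y = 0
    · exact ⟨0, by ext a; simp [h0, grad]⟩
    obtain ⟨a₀, ha₀⟩ := Function.ne_iff.1 h0
    let E : Set (Arc G) := {a | y a = 0}
    let H : SimpleGraph V := SimpleGraph.fromRel fun v w => ∃ h : G.Adj v w, y ⟨(v, w), h⟩ = 0
    have hH : ∀ v w, H.Adj v w → ∃ a ∈ E, a.1 = (v, w) ∨ a.1 = (w, v) := by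
      rintro v w ⟨-, ⟨h, hy⟩ | ⟨h, hy⟩⟩
      · exact ⟨_, hy, Or.inl rfl⟩
      · exact ⟨_, hy, Or.inr rfl⟩
    -- A path of arcs with `y = 0` joining the ends of `a₀` would close up with `a₀` to an oriented
    -- cycle whose product with `y` is `y a₀ ≠ 0`.
    have hreach : ¬ H.Reachable a₀.1.1 a₀.1.2 := by
      intro hr
      obtain ⟨p, hp⟩ := hr.exists_isPath
      obtain ⟨c, h1, h2, h3⟩ := exists_flow_of_isPath hH p hp
      have hc₀ : c a₀ = 0 := by
        by_contra hne
        exact ha₀ (h2 _ hne).1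
      have hcyc : IsOrientedCycle G (Pi.single a₀ 1 - c) := by
        refine ⟨fun b => ?_, ?_⟩
        · by_cases hb : b = a₀
          · subst hb; simp [hc₀]
          · simp [hb]
            have := h1 b
            omega
        · rw [Matrix.mulVec_sub, incidence_mulVec_single, h3, sub_self]
      have hdot := hy _ hcyc
      have : (fun a => (((Pi.single a₀ 1 - c : Arc G → ℤ) a : ℤ) : ℝ)) ⬝ᵥ y = y a₀ := by
        rw [dotProduct, Finset.sum_eq_single a₀]
        · simp [hc₀]
        · intro b _ hb
          by_cases hcb : c b = 0
          · simp [hb, hcb]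
          · rw [show y b = 0 from (h2 b hcb).1, mul_zero]
        · simp
      exact ha₀ (this ▸ hdot)
    classical
    -- Constant on components of `H`, so its gradient vanishes wherever `y` does; the ends of `a₀`
    -- lie in different components.
    let π : V → ℝ := fun v => if H.Reachable a₀.1.1 v then y a₀ else 0
    have hπ : ∀ a, y a = 0 → grad G π a = 0 := by
      intro a ha
      have : H.Reachable a₀.1.1 a.1.1 ↔ H.Reachable a₀.1.1 a.1.2 := by
        by_cases hv : a.1.1 = a.1.2
        · rw [hv]
        · have hadj : H.Adj a.1.1 a.1.2 := ⟨hv, Or.inl ⟨a.2, ha⟩⟩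
          exact ⟨fun h => h.trans hadj.reachable, fun h => h.trans hadj.symm.reachable⟩
      simp [grad, π, this]
    have hπ₀ : grad G π a₀ = y a₀ := by simp [grad, π, hreach]
    have hlt : fixedCoords (y - grad G π) ⊂ fixedCoords y := by
      refine Finset.ssubset_iff_of_subset (fun a ha => ?_) |>.2 ⟨a₀, ?_, ?_⟩
      · rw [mem_fixedCoords] at ha ⊢
        intro h
        exact ha (by simp [h, hπ a h])
      · exact mem_fixedCoords.2 ha₀
      · exact notMem_fixedCoords.2 (by simp [hπ₀])
    obtain ⟨ρ, hρ⟩ := ih _ (Finset.card_lt_card hlt) (y - grad G π) (fun γ hγ => by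
      rw [dotProduct_sub, hy γ hγ, hγ.dotProduct_grad, sub_zero]) rfl
    exact ⟨ρ + π, by rw [grad_add, ← hρ]; simp⟩

/-- Unit flows along the edges of a relation in which `i` is reachable from every vertex add up to
a flow with excess `1` at all vertices other than `i`. -/
lemma exists_unit_excess {R : V → V → Prop} {i : V} (Q : AddSubmonoid (Arc G → ℝ))
    (hR : ∀ v w, R v w →
      ∃ c ∈ Q, (incidence ℝ G).mulVec c = Pi.single v 1 - Pi.single w 1)
    (hreach : ∀ j, Relation.ReflTransGen R j i) :
    ∃ c ∈ Q, ∀ j, j ≠ i → (incidence ℝ G).mulVec c j = 1 := by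
  have key : ∀ j, ∃ c ∈ Q, (incidence ℝ G).mulVec c = Pi.single j 1 - Pi.single i 1 := by
    intro j
    induction hreach j using Relation.ReflTransGen.head_induction_on with
    | refl => exact ⟨0, Q.zero_mem, by simp⟩
    | head h _ ih =>
      obtain ⟨c, hc, h1⟩ := ih
      obtain ⟨d, hd, h2⟩ := hR _ _ h
      exact ⟨d + c, Q.add_mem hd hc, by rw [Matrix.mulVec_add, h1, h2]; abel⟩
  choose c hc h using key
  refine ⟨∑ j, c j, Q.sum_mem fun j _ => hc j, fun k hk => ?_⟩
  have : (incidence ℝ G).mulVec (∑ j, c j) = ∑ j, (incidence ℝ G).mulVec (c j) :=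
    map_sum (incidence ℝ G).mulVecLin _ _
  rw [this, Finset.sum_apply, Finset.sum_congr rfl fun j _ => congrFun (h j) k]
  simp [Pi.single_apply, hk]

lemma exists_unit_excess_of_weaklyConnected (hG : WeaklyConnected G) (i : V) :
    ∃ c : Arc G → ℝ, ∀ j, j ≠ i → (incidence ℝ G).mulVec c j = 1 := by
  have hR : ∀ v w, G.toSimpleGraphInclusive.Adj v w → ∃ c ∈ (⊤ : AddSubmonoid (Arc G → ℝ)),
      (incidence ℝ G).mulVec c = Pi.single v 1 - Pi.single w 1 := by
    rintro v w ⟨-, h | h⟩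
    · exact ⟨_, AddSubmonoid.mem_top _, incidence_mulVec_single ℝ (⟨(v, w), h⟩ : Arc G)⟩
    · refine ⟨-Pi.single ⟨(w, v), h⟩ 1, AddSubmonoid.mem_top _, ?_⟩
      rw [Matrix.mulVec_neg, incidence_mulVec_single, neg_sub]
  obtain ⟨c, -, h⟩ := exists_unit_excess ⊤ hR fun j =>
    (SimpleGraph.reachable_iff_reflTransGen j i).1 (hG.preconnected j i)
  exact ⟨c, h⟩

/-- The functionals that are negative on the columns of `Bᵀ` other than the `i`-th. -/
def NegativeOff (i : V) (c : Arc G → ℝ) : Prop := ∀ j, j ≠ i → (incidence ℝ G).mulVec c j < 0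

/-- Summation by parts turns the pairing into `∑ min(π_v, 0) (Bc)_v`, whose terms are all
nonnegative. They therefore vanish, and strict negativity of the excess forces `min(π_v, 0) = 0`. -/
lemma NegativeOff.nonneg {i : V} {c : Arc G → ℝ} (hc : NegativeOff i c) {π : V → ℝ}
    (hi : π i = 0) (h : c ⬝ᵥ grad G (fun v => min (π v) 0) ≤ 0) (j : V) : 0 ≤ π j := by
  rw [dotProduct_grad] at h
  have hterm : ∀ v ∈ Finset.univ, 0 ≤ min (π v) 0 * (incidence ℝ G).mulVec c v := by
    intro v _
    by_cases hv : v = i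
    · simp [hv, hi]
    · exact mul_nonneg_of_nonpos_of_nonpos (min_le_right _ _) (hc v hv).le
  have h0 := (Finset.sum_eq_zero_iff_of_nonneg hterm).1 (le_antisymm h (Finset.sum_nonneg hterm)) j
    (Finset.mem_univ j)
  by_cases hj : j = i
  · rw [hj, hi]
  · rcases mul_eq_zero.1 h0 with h1 | h1
    · exact min_eq_right_iff.1 h1
    · exact absurd h1 (hc j hj).ne

/-- Points on faces exposed by negative functionals are minimal in their fibres. -/
lemma NegativeOff.potential_nonneg {i : V} {c l u x : Arc G → ℝ} (hc : NegativeOff i c)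
    (hx : x ∈ boxFace l u c) {π : V → ℝ} (hi : π i = 0) (hy : x + grad G π ∈ Set.Icc l u) (j : V) :
    0 ≤ π j := by
  refine hc.nonneg hi ?_ j
  -- Along each arc the difference of `min(π, 0)` lies between `0` and the difference of `π`.
  have hmem : x + grad G (fun v => min (π v) 0) ∈ Set.Icc l u := by
    constructor <;> intro a
    · have h1 := (hx a).1
      have h2 := hy.1 a
      simp only [Pi.add_apply, grad] at h2 ⊢
      rcases min_cases (π a.1.1) 0 with ⟨h3, h4⟩ | ⟨h3, h4⟩ <;>
      rcases min_cases (π a.1.2) 0 with ⟨h5, h6⟩ | ⟨h5, h6⟩ <;> rw [h3, h5] <;> linarith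
    · have h1 := (hx a).2.1
      have h2 := hy.2 a
      simp only [Pi.add_apply, grad] at h2 ⊢
      rcases min_cases (π a.1.1) 0 with ⟨h3, h4⟩ | ⟨h3, h4⟩ <;>
      rcases min_cases (π a.1.2) 0 with ⟨h5, h6⟩ | ⟨h5, h6⟩ <;> rw [h3, h5] <;> linarith
  have := isMaxOn_of_mem_boxFace hx hmem
  rw [dotProduct_add] at this
  linarith

/-- No nonzero gradient is parallel to the face of `c`: truncating `π` or `-π` keeps the pairing
with `c` at zero, so both are nonnegative. -/
lemma grad_eq_zero_of_dotProduct_support {i : V} {c : Arc G → ℝ} (hc : NegativeOff i c)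
    {π : V → ℝ} (hi : π i = 0) (h : ∀ a, c a = 0 ∨ grad G π a = 0) : grad G π = 0 := by
  have aux : ∀ ρ : V → ℝ, ρ i = 0 → (∀ a, c a = 0 ∨ grad G ρ a = 0) → ∀ j, 0 ≤ ρ j := by
    intro ρ hρ h
    refine hc.nonneg hρ (le_of_eq (Finset.sum_eq_zero fun a _ => ?_))
    rcases h a with ha | ha
    · simp [ha]
    · simp [grad, sub_eq_zero.1 ha]
  have h1 := aux π hi h
  have h2 := aux ((-1 : ℝ) • π) (by simp [hi]) (fun a => (h a).imp_right fun h => by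
    rw [grad_smul, Pi.smul_apply, h, smul_zero])
  have : π = 0 := funext fun j => le_antisymm (by simpa using h2 j) (h1 j)
  ext a
  simp [this, grad]

end Incidence

lemma exists_sub_smul_mem_Icc {A : Type*} [Fintype A] {l u x g : A → ℝ} (hx : x ∈ Set.Icc l u)
    (h1 : ∀ a, 0 < g a → l a < x a) (h2 : ∀ a, g a < 0 → x a < u a) :
    ∃ ε : ℝ, 0 < ε ∧ x - ε • g ∈ Set.Icc l u := by
  -- The slacks to both bounds are treated as one vector; positive slacks stay positive for small
  -- `ε`.
  obtain ⟨ε, hε, h⟩ := exists_pos_add_smul_sign (Sum.elim (x - l) (u - x)) (Sum.elim (-g) g)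
  refine ⟨ε, hε, fun a => ?_, fun a => ?_⟩
  · have := (h (Sum.inl a)).1
    simp only [Sum.elim_inl, Pi.sub_apply, Pi.neg_apply, sub_pos] at this
    simp only [Pi.sub_apply, Pi.smul_apply, smul_eq_mul]
    rcases (hx.1 a).lt_or_eq with h3 | h3
    · linarith [this h3]
    · have : g a ≤ 0 := le_of_not_gt fun hg => (h1 a hg).ne h3
      nlinarith
  · have := (h (Sum.inr a)).1
    simp only [Sum.elim_inr, Pi.sub_apply, sub_pos] at this
    simp only [Pi.sub_apply, Pi.smul_apply, smul_eq_mul]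
    rcases (hx.2 a).lt_or_eq with h3 | h3
    · linarith [this h3]
    · have : 0 ≤ g a := le_of_not_gt fun hg => (h2 a hg).ne h3
      nlinarith

/-! ### Kernel and row independence of the cycle matrix -/

section CycleMatrix

variable {V : Type*} [Fintype V] [DecidableEq V] {G : Digraph V} [DecidableRel G.Adj]

lemma IntegralCycleBasis.cycleMatrix_mulVec_grad (𝓑 : IntegralCycleBasis G) (π : V → ℝ) :
    𝓑.cycleMatrix.mulVec (grad G π) = 0 :=
  funext fun k => (𝓑.isOrientedCycle k).dotProduct_grad π

/-- Orthogonality to the basis extends to all oriented cycles because the basis generates them; a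
constant shift of the potential normalises it at `i`. -/
lemma IntegralCycleBasis.exists_eq_grad (𝓑 : IntegralCycleBasis G) (i : V) {y : Arc G → ℝ}
    (hy : 𝓑.cycleMatrix.mulVec y = 0) : ∃ π : V → ℝ, π i = 0 ∧ y = grad G π := by
  have key : ∀ γ ∈ Submodule.span ℤ (Set.range 𝓑.γ), (fun a => (γ a : ℝ)) ⬝ᵥ y = 0 := by
    intro γ hγ
    induction hγ using Submodule.span_induction with
    | mem γ h => obtain ⟨k, rfl⟩ := h; exact congrFun hy k
    | zero => simp [dotProduct]
    | add γ δ _ _ h1 h2 =>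
      have : (fun a => (((γ + δ) a : ℤ) : ℝ)) = (fun a => (γ a : ℝ)) + fun a => (δ a : ℝ) := by
        ext a; simp
      rw [this, add_dotProduct, h1, h2, add_zero]
    | smul t γ _ h =>
      have : (fun a => (((t • γ) a : ℤ) : ℝ)) = (t : ℝ) • fun a => (γ a : ℝ) := by
        ext a; simp
      rw [this, smul_dotProduct, h, smul_zero]
  rw [𝓑.generates] at key
  obtain ⟨π, rfl⟩ := exists_eq_grad_of_orthogonal y fun γ hγ => key γ (Submodule.subset_span hγ)
  exact ⟨fun v => π v - π i, by simp, by ext a; simp [grad]⟩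

/-- A generating family with as many members as the rank is independent. -/
lemma IntegralCycleBasis.linearIndependent (𝓑 : IntegralCycleBasis G) :
    LinearIndependent ℤ 𝓑.γ := by
  have hmem : ∀ k, 𝓑.γ k ∈ cycleSpace G := fun k => Submodule.subset_span (𝓑.isOrientedCycle k)
  have : LinearIndependent ℤ fun k => (⟨𝓑.γ k, hmem k⟩ : cycleSpace G) := by
    refine linearIndependent_of_top_le_span_of_card_eq_finrank ?_ (Fintype.card_fin _)
    rintro ⟨x, hx⟩ -
    have hx' := hx
    rw [← 𝓑.generates] at hx'
    have himg : Set.range 𝓑.γ =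
        (cycleSpace G).subtype '' Set.range fun k => (⟨𝓑.γ k, hmem k⟩ : cycleSpace G) := by
      rw [← Set.range_comp]; rfl
    rw [himg, Submodule.span_image] at hx'
    obtain ⟨y, hy, rfl⟩ := hx'
    exact hy
  exact this.map' (cycleSpace G).subtype (Submodule.ker_subtype _)

/-- Independence passes from `ℤ` to `ℝ` through the Gram determinant, an integer that is nonzero
over both rings. -/
lemma IntegralCycleBasis.vecMul_cycleMatrix_eq_zero (𝓑 : IntegralCycleBasis G)
    {d : Fin (cyclomaticNumber G) → ℝ} (hd : Matrix.vecMul d 𝓑.cycleMatrix = 0) : d = 0 := by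
  let M : Matrix (Fin (cyclomaticNumber G)) (Arc G) ℤ := Matrix.of 𝓑.γ
  have hdet : (M * M.transpose).det ≠ 0 := by
    intro h
    obtain ⟨v, hv, hv0⟩ := Matrix.exists_vecMul_eq_zero_iff.2 h
    have h1 : Matrix.vecMul v M ⬝ᵥ Matrix.vecMul v M = 0 := by
      have : Matrix.vecMul v M ⬝ᵥ Matrix.vecMul v M = Matrix.vecMul v (M * M.transpose) ⬝ᵥ v := by
        rw [← Matrix.vecMul_vecMul, ← Matrix.dotProduct_mulVec, Matrix.vecMul_transpose,
          dotProduct_comm]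
      rw [this, hv0, zero_dotProduct]
    rw [dotProduct_self_eq_zero] at h1
    have h2 := Fintype.linearIndependent_iff.1 𝓑.linearIndependent v (by
      ext a
      simpa [Matrix.vecMul, dotProduct, M] using congrFun h1 a)
    exact hv (funext h2)
  have hmap : 𝓑.cycleMatrix = M.map (Int.castRingHom ℝ) := by
    ext k a; simp [cycleMatrix, M]
  by_contra hne
  have : (𝓑.cycleMatrix * 𝓑.cycleMatrix.transpose).det = 0 :=
    Matrix.exists_vecMul_eq_zero_iff.1 ⟨d, hne, by
      rw [← Matrix.vecMul_vecMul, hd, Matrix.zero_vecMul]⟩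
  rw [hmap, ← Matrix.transpose_map, ← Matrix.map_mul, ← RingHom.mapMatrix_apply,
    ← RingHom.map_det] at this
  exact hdet (by simpa using this)

end CycleMatrix

end PESP

/-! ### The projection along `Γ / T` and the scaled cycle matrix -/

namespace PESP

open Zono

variable {V : Type*} {G : Digraph V}

lemma Instance.T_ne_zero (I : Instance G) : (I.T : ℝ) ≠ 0 := Nat.cast_ne_zero.2 I.T_pos.ne'

variable [DecidableEq V]

lemma grad_single_mem_hull {i j : V} (hj : j ≠ i) :
    grad G (Pi.single j 1) ∈ PointedCone.hull ℝ
      {c | ∃ j, j ≠ i ∧ c = (incidence ℝ G).transpose.col j} := by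
  refine Submodule.subset_span ⟨j, hj, ?_⟩
  ext a
  simp [grad, incidence, Matrix.col, Pi.single_apply]

lemma Instance.Icc_subset_P (I : Instance G) (i : V) : Set.Icc I.l I.u ⊆ I.P i := fun x hx =>
  ⟨x, ⟨hx.1, hx.2⟩, 0, Submodule.zero_mem _, add_zero x⟩

variable [Fintype V] [DecidableRel G.Adj]

/-- The map `x ↦ Γ x / T` as a linear map. -/
def Instance.projₗ (I : Instance G) (𝓑 : IntegralCycleBasis G) :
    (Arc G → ℝ) →ₗ[ℝ] (Fin (cyclomaticNumber G) → ℝ) :=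
  (1 / (I.T : ℝ)) • 𝓑.cycleMatrix.mulVecLin

@[simp] lemma Instance.coe_projₗ (I : Instance G) (𝓑 : IntegralCycleBasis G) :
    ⇑(I.projₗ 𝓑) = I.proj 𝓑 := rfl

lemma Instance.projₗ_grad (I : Instance G) (𝓑 : IntegralCycleBasis G) (π : V → ℝ) :
    I.projₗ 𝓑 (grad G π) = 0 := by
  simp [Instance.proj, 𝓑.cycleMatrix_mulVec_grad]

lemma Instance.exists_eq_grad (I : Instance G) (𝓑 : IntegralCycleBasis G) (i : V)
    {y : Arc G → ℝ} (h : I.projₗ 𝓑 y = 0) : ∃ π : V → ℝ, π i = 0 ∧ y = grad G π := by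
  refine 𝓑.exists_eq_grad i ?_
  simpa [Instance.proj, I.T_ne_zero] using h

lemma Instance.Z_eq_image (I : Instance G) (𝓑 : IntegralCycleBasis G) :
    I.Z 𝓑 = I.projₗ 𝓑 '' Set.Icc I.l I.u := by
  ext z
  constructor
  · rintro ⟨x, h, h1, h2⟩
    refine ⟨x, ⟨h1, h2⟩, ?_⟩
    simp [Instance.proj, h, smul_smul, I.T_ne_zero]
  · rintro ⟨x, ⟨h1, h2⟩, rfl⟩
    exact ⟨x, by simp [Instance.proj, smul_smul, I.T_ne_zero], h1, h2⟩

lemma Instance.col_scaledCycleMatrix (I : Instance G) (𝓑 : IntegralCycleBasis G) (a : Arc G) :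
    (I.scaledCycleMatrix 𝓑).col a = (I.u a - I.l a) • I.projₗ 𝓑 (Pi.single a 1) := by
  ext k
  simp [Instance.scaledCycleMatrix, Instance.proj, Matrix.col]
  ring

lemma Instance.image_boxFace_eq_zonotope (I : Instance G) (𝓑 : IntegralCycleBasis G)
    (hlu : ∀ a, I.l a < I.u a) (c : Arc G → ℝ) :
    I.projₗ 𝓑 '' boxFace I.l I.u c =
      zonotope (deleteCols (I.scaledCycleMatrix 𝓑) (fixedCoords c))
        (I.projₗ 𝓑 (lowVertex I.l I.u c)) := by
  rw [image_boxFace hlu, zonotope_deleteCols]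
  congr 2
  ext1 a
  exact (I.col_scaledCycleMatrix 𝓑 a.1).symm

lemma Instance.isZonotope_Z (I : Instance G) (𝓑 : IntegralCycleBasis G)
    (hlu : ∀ a, I.l a < I.u a) : ∃ b, I.Z 𝓑 = zonotope (I.scaledCycleMatrix 𝓑) b := by
  refine ⟨I.projₗ 𝓑 I.l, ?_⟩
  have hmul : ∀ t : Arc G → ℝ, (I.scaledCycleMatrix 𝓑).mulVec t =
      I.projₗ 𝓑 (fun a => (I.u a - I.l a) * t a) := by
    intro t
    ext k
    simp only [Instance.scaledCycleMatrix, Instance.coe_projₗ, Instance.proj, Matrix.mulVec,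
      dotProduct, Pi.smul_apply, smul_eq_mul, Finset.mul_sum]
    refine Finset.sum_congr rfl fun a _ => ?_
    ring
  rw [I.Z_eq_image]
  ext z
  constructor
  · rintro ⟨x, hx, rfl⟩
    refine ⟨fun a => (x a - I.l a) / (I.u a - I.l a), fun a => ⟨?_, ?_⟩, ?_⟩
    · exact div_nonneg (sub_nonneg.2 (hx.1 a)) (sub_pos.2 (hlu a)).le
    · exact (div_le_one (sub_pos.2 (hlu a))).2 (sub_le_sub_right (hx.2 a) _)
    · rw [hmul, ← map_add]
      congr 1
      ext a
      have := (sub_pos.2 (hlu a)).ne'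
      simp only [Pi.add_apply]
      field_simp
      ring
  · rintro ⟨t, ht, rfl⟩
    refine ⟨(fun a => (I.u a - I.l a) * t a) + I.l, ⟨fun a => ?_, fun a => ?_⟩, ?_⟩
    · have := mul_nonneg (sub_pos.2 (hlu a)).le (ht a).1
      simp only [Pi.add_apply]
      linarith
    · have := mul_le_mul_of_nonneg_left (ht a).2 (sub_pos.2 (hlu a)).le
      simp only [Pi.add_apply]
      linarith
    · rw [map_add, hmul]

/-! ### Bounded faces -/

/-- Strictness on all nonzero cone elements is what keeps maximisers over `P_i` inside the box: a
point `y + k` with `k ≠ 0` is beaten by `y`. -/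
lemma NegativeOff.dotProduct_neg_or_eq_zero {i : V} {c : Arc G → ℝ} (hc : NegativeOff i c)
    {k : Arc G → ℝ} (hk : k ∈ PointedCone.hull ℝ
      {c | ∃ j, j ≠ i ∧ c = (incidence ℝ G).transpose.col j}) : c ⬝ᵥ k < 0 ∨ k = 0 := by
  induction hk using Submodule.span_induction with
  | mem x h =>
    obtain ⟨j, hj, rfl⟩ := h
    left
    rw [dotProduct_comm]
    exact hc j hj
  | zero => exact Or.inr rfl
  | add x y _ _ hx hy =>
    rcases hx with hx | rfl <;> rcases hy with hy | rfl
    · left; rw [dotProduct_add]; exact add_neg hx hy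
    · left; simpa using hx
    · left; simpa using hy
    · right; simp
  | smul t x _ hx =>
    rcases hx with hx | rfl
    · rcases t.2.lt_or_eq with ht | ht
      · left
        have : c ⬝ᵥ (t • x) = (t : ℝ) * (c ⬝ᵥ x) := dotProduct_smul (t : ℝ) c x
        rw [this]
        exact mul_neg_of_pos_of_neg ht hx
      · right
        have : t = 0 := Subtype.ext ht.symm
        simp [this]
    · right; simp

lemma NegativeOff.boxFace_eq_argmax_P {I : Instance G} (hlu : ∀ a, I.l a < I.u a) {i : V}
    {c : Arc G → ℝ} (hc : NegativeOff i c) :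
    boxFace I.l I.u c = {x ∈ I.P i | ∀ y ∈ I.P i, c ⬝ᵥ y ≤ c ⬝ᵥ x} := by
  ext x
  constructor
  · refine fun hx => ⟨I.Icc_subset_P i (boxFace_subset_Icc _ _ _ hx), ?_⟩
    rintro _ ⟨y, hy, k, hk, rfl⟩
    have h1 := isMaxOn_of_mem_boxFace hx (y := y) hy
    have h2 : c ⬝ᵥ k ≤ 0 := by
      rcases hc.dotProduct_neg_or_eq_zero hk with h | rfl
      · exact h.le
      · simp
    rw [dotProduct_add]
    linarith
  · rintro ⟨⟨y, hy, k, hk, rfl⟩, hmax⟩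
    have hmax' : ∀ w ∈ Set.Icc I.l I.u, c ⬝ᵥ w ≤ c ⬝ᵥ (y + k) := fun w hw =>
      hmax w (I.Icc_subset_P i hw)
    rcases hc.dotProduct_neg_or_eq_zero hk with h | rfl
    · have := hmax' y hy
      rw [dotProduct_add] at this
      linarith
    · simp only [add_zero] at hmax' ⊢
      exact mem_boxFace_of_isMaxOn (fun a => (hlu a).le) hy hmax'

/-- A positive excess at `j ≠ i` would leave the functional unbounded on `P_i`, and a zero excess
would put a whole ray in direction `grad G (Pi.single j 1)` into the face. -/
lemma Instance.mem_boundedFaces_iff (I : Instance G) (hG : WeaklyConnected G)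
    (hlu : ∀ a, I.l a < I.u a) {i : V} {F : Set (Arc G → ℝ)} :
    F ∈ I.boundedFaces i ↔ ∃ c, NegativeOff i c ∧ F = boxFace I.l I.u c := by
  constructor
  · rintro ⟨hF, hbdd⟩
    obtain ⟨⟨x, hx⟩, c, rfl⟩ := isFace_iff_dotProduct.1 hF
    suffices hc : NegativeOff i c from ⟨c, hc, (hc.boxFace_eq_argmax_P hlu).symm⟩
    intro j hj
    have hmem : ∀ t : ℝ, 0 ≤ t → x + t • grad G (Pi.single j 1) ∈ I.P i := by
      intro t ht
      obtain ⟨y, hy, k, hk, rfl⟩ := hx.1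
      refine ⟨y, hy, k + t • grad G (Pi.single j 1), ?_, (add_assoc _ _ _).symm⟩
      exact Submodule.add_mem _ hk
        (Submodule.smul_mem _ (⟨t, ht⟩ : {t : ℝ // 0 ≤ t}) (grad_single_mem_hull hj))
    have hdot : ∀ t : ℝ, c ⬝ᵥ (x + t • grad G (Pi.single j 1)) =
        c ⬝ᵥ x + t * (incidence ℝ G).mulVec c j := by
      intro t
      rw [dotProduct_add, dotProduct_smul, ← incidence_mulVec_apply, smul_eq_mul]
    by_contra hneg
    have h0 : (incidence ℝ G).mulVec c j = 0 := by
      have := hx.2 _ (hmem 1 zero_le_one)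
      rw [hdot] at this
      linarith
    obtain ⟨C, hC⟩ := hbdd.exists_norm_le
    have hray : ∀ t : ℝ, 0 ≤ t → ‖x + t • grad G (Pi.single j 1)‖ ≤ C := fun t ht =>
      hC _ ⟨hmem t ht, fun y hy => by rw [hdot, h0, mul_zero, add_zero]; exact hx.2 y hy⟩
    -- Weak connectedness enters here: some flow has excess `1` at `j`, so this column of `Bᵀ`
    -- cannot vanish.
    have hb : grad G (Pi.single j 1) ≠ 0 := by
      intro hb
      obtain ⟨d, hd⟩ := exists_unit_excess_of_weaklyConnected hG i
      have := hd j hj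
      rw [incidence_mulVec_apply, hb, dotProduct_zero] at this
      exact zero_ne_one this
    have hpos := norm_pos_iff.2 hb
    set b := grad G (Pi.single j 1)
    have hC0 : 0 ≤ C := (norm_nonneg _).trans (hray 0 le_rfl)
    -- With this step length the point on the ray has norm at least `C + 1`.
    have ht : 0 ≤ (C + ‖x‖ + 1) / ‖b‖ := by positivity
    have h1 := hray _ ht
    have h2 : ‖((C + ‖x‖ + 1) / ‖b‖) • b‖ = C + ‖x‖ + 1 := by
      rw [norm_smul, Real.norm_of_nonneg ht, div_mul_cancel₀ _ hpos.ne']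
    have h3 := norm_sub_norm_le (((C + ‖x‖ + 1) / ‖b‖) • b) (-x)
    rw [sub_neg_eq_add, norm_neg, add_comm _ x, h2] at h3
    linarith
  · rintro ⟨c, hc, rfl⟩
    refine ⟨isFace_iff_dotProduct.2 ⟨⟨_, lowVertex_mem (fun a => (hlu a).le) c⟩, c,
      hc.boxFace_eq_argmax_P hlu⟩, ?_⟩
    exact (Metric.isBounded_Icc I.l I.u).subset (boxFace_subset_Icc _ _ _)

lemma Instance.isFace_boxFace (I : Instance G) (hlu : ∀ a, I.l a < I.u a) (c : Arc G → ℝ) :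
    IsFace I.XLP (boxFace I.l I.u c) :=
  isFace_iff_dotProduct.2 ⟨⟨_, lowVertex_mem (fun a => (hlu a).le) c⟩, c,
    boxFace_eq_argmax (fun a => (hlu a).le) c⟩

/-! ### The projection of the bounded faces -/

/-- Two such points in one fibre differ by `grad π` with `π i = 0`; each being lowest in the fibre
gives `π ≥ 0` and `-π ≥ 0`. -/
lemma Instance.injOn_projₗ (I : Instance G) (𝓑 : IntegralCycleBasis G) (i : V) :
    Set.InjOn (I.projₗ 𝓑) {x | ∃ c, NegativeOff i c ∧ x ∈ boxFace I.l I.u c} := by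
  rintro x ⟨c, hc, hx⟩ y ⟨d, hd, hy⟩ hxy
  obtain ⟨π, hi, hπ⟩ := I.exists_eq_grad 𝓑 i (y := y - x) (by rw [map_sub, hxy, sub_self])
  have hyx : y = x + grad G π := by rw [← hπ]; abel
  have hxy' : x = y + grad G ((-1 : ℝ) • π) := by rw [grad_smul, ← hπ]; simp
  have h1 := hc.potential_nonneg hx hi (hyx ▸ boxFace_subset_Icc _ _ _ hy)
  have h2 := hd.potential_nonneg hy (π := (-1 : ℝ) • π) (by simp [hi])
    (hxy' ▸ boxFace_subset_Icc _ _ _ hx)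
  have h0 : π = 0 := funext fun j => le_antisymm (by simpa using h2 j) (h1 j)
  rw [hyx, h0]
  ext a
  simp [grad]

lemma NegativeOff.subset_of_image_subset {I : Instance G} {𝓑 : IntegralCycleBasis G} {i : V}
    {c d : Arc G → ℝ} (hc : NegativeOff i c) (hd : NegativeOff i d)
    (h : I.projₗ 𝓑 '' boxFace I.l I.u c ⊆ I.projₗ 𝓑 '' boxFace I.l I.u d) :
    boxFace I.l I.u c ⊆ boxFace I.l I.u d := by
  intro x hx
  obtain ⟨y, hy, hyx⟩ := h ⟨x, hx, rfl⟩
  rwa [← I.injOn_projₗ 𝓑 i ⟨d, hd, hy⟩ ⟨c, hc, hx⟩ hyx]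

lemma NegativeOff.eq_zero_of_projₗ_eq_zero {I : Instance G} {𝓑 : IntegralCycleBasis G} {i : V}
    {c : Arc G → ℝ} (hc : NegativeOff i c) {y : Arc G → ℝ} (hy : ∀ a, c a = 0 ∨ y a = 0)
    (h : I.projₗ 𝓑 y = 0) : y = 0 := by
  obtain ⟨π, hi, rfl⟩ := I.exists_eq_grad 𝓑 i h
  exact grad_eq_zero_of_dotProduct_support hc hi hy

/-- A vanishing combination comes from a kernel vector supported on the free coordinates, and
`eq_zero_of_projₗ_eq_zero` excludes nonzero ones. -/
lemma NegativeOff.linearIndependent {I : Instance G} (𝓑 : IntegralCycleBasis G) {i : V}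
    {c : Arc G → ℝ} (hc : NegativeOff i c) :
    LinearIndependent ℝ fun a : {a // a ∉ fixedCoords c} => I.projₗ 𝓑 (Pi.single a.1 1) := by
  refine Fintype.linearIndependent_iff.2 fun t ht a => ?_
  have h := hc.eq_zero_of_projₗ_eq_zero (I := I) (𝓑 := 𝓑)
    (y := ∑ a : {a // a ∉ fixedCoords c}, t a • Pi.single a.1 1) (fun b => ?_) ?_
  · have := congrFun h a.1
    rw [Finset.sum_apply, Finset.sum_eq_single a] at this
    · simpa using this
    · intro b _ hb
      have : a.1 ≠ b.1 := fun h => hb (Subtype.ext h.symm)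
      simp [this]
    · simp
  · by_cases hb : c b = 0
    · exact Or.inl hb
    · right
      rw [Finset.sum_apply]
      refine Finset.sum_eq_zero fun a _ => ?_
      have : b ≠ a.1 := fun h => hb (h ▸ notMem_fixedCoords.1 a.2)
      simp [this]
  · simpa using ht

lemma NegativeOff.linearIndependent_smul {I : Instance G} (hlu : ∀ a, I.l a < I.u a)
    (𝓑 : IntegralCycleBasis G) {i : V} {c : Arc G → ℝ} (hc : NegativeOff i c) :
    LinearIndependent ℝ fun a : {a // a ∉ fixedCoords c} =>
      (I.u a.1 - I.l a.1) • I.projₗ 𝓑 (Pi.single a.1 1) :=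
  (hc.linearIndependent 𝓑).units_smul fun a => Units.mk0 _ (sub_pos.2 (hlu a.1)).ne'

lemma NegativeOff.dim_boxFace {I : Instance G} (hlu : ∀ a, I.l a < I.u a)
    (𝓑 : IntegralCycleBasis G) {i : V} {c : Arc G → ℝ} (hc : NegativeOff i c) :
    dim (boxFace I.l I.u c) = Fintype.card {a // a ∉ fixedCoords c} := by
  have h := image_boxFace hlu c LinearMap.id
  rw [LinearMap.id_coe, Set.image_id] at h
  rw [h]
  refine dim_vadd_parallelepiped _ (LinearIndependent.of_comp (I.projₗ 𝓑) ?_)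
  simp only [Function.comp_def, map_smul]
  exact hc.linearIndependent_smul hlu 𝓑

lemma NegativeOff.isParallelotope_image {I : Instance G} (hlu : ∀ a, I.l a < I.u a)
    (𝓑 : IntegralCycleBasis G) {i : V} {c : Arc G → ℝ} (hc : NegativeOff i c) :
    IsParallelotope (dim (boxFace I.l I.u c)) (I.projₗ 𝓑 '' boxFace I.l I.u c) := by
  rw [hc.dim_boxFace hlu 𝓑, image_boxFace hlu]
  exact isParallelotope_vadd_parallelepiped _ (hc.linearIndependent_smul hlu 𝓑)

lemma NegativeOff.dim_boxFace_le {I : Instance G} (hlu : ∀ a, I.l a < I.u a)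
    (𝓑 : IntegralCycleBasis G) {i : V} {c : Arc G → ℝ} (hc : NegativeOff i c) :
    dim (boxFace I.l I.u c) ≤ cyclomaticNumber G := by
  rw [hc.dim_boxFace hlu 𝓑]
  simpa using (hc.linearIndependent (I := I) 𝓑).fintype_card_le_finrank

end PESP

namespace PESP

open Zono

variable {V : Type*} [Fintype V] [DecidableEq V] {G : Digraph V} [DecidableRel G.Adj]

/-! ### The images of the bounded faces cover `Z` -/

/-- The linear functionals whose minimum over the box `[l, u]` is attained at `x`. -/
def normalCone (l u x : Arc G → ℝ) : AddSubmonoid (Arc G → ℝ) where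
  carrier := {c | ∀ a, (0 < c a → x a = l a) ∧ (c a < 0 → x a = u a)}
  zero_mem' := by simp
  add_mem' := by
    intro c d hc hd a
    simp only [Pi.add_apply]
    refine ⟨fun h => ?_, fun h => ?_⟩
    · by_cases h1 : 0 < c a
      · exact (hc a).1 h1
      · exact (hd a).1 (by linarith)
    · by_cases h1 : c a < 0
      · exact (hc a).2 h1
      · exact (hd a).2 (by linarith)

/-- The residual relation at `x`: if `π` decreases at `v` but not at `w`, then `x + grad π` leaves
the box immediately. -/
def residual (l u x : Arc G → ℝ) (v w : V) : Prop :=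
  ∃ a : Arc G, (a.1 = (v, w) ∧ x a = l a) ∨ (a.1 = (w, v) ∧ x a = u a)

/-- Each residual edge carries a unit flow in the normal cone. Summing these flows along routes to
`i` gives excess `1` off `i`, and negation turns minimisation into maximisation. -/
lemma exists_negativeOff_of_reachable {l u x : Arc G → ℝ} (hx : x ∈ Set.Icc l u) {i : V}
    (h : ∀ j, Relation.ReflTransGen (residual l u x) j i) :
    ∃ c, NegativeOff i c ∧ x ∈ boxFace l u c := by
  have hR : ∀ v w, residual l u x v w → ∃ c ∈ normalCone l u x,
      (incidence ℝ G).mulVec c = Pi.single v 1 - Pi.single w 1 := by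
    rintro v w ⟨a, ⟨ha, hxa⟩ | ⟨ha, hxa⟩⟩
    · refine ⟨Pi.single a 1, fun b => ?_, by rw [incidence_mulVec_single, ha]⟩
      by_cases hb : b = a
      · subst hb; simpa [not_lt.2 zero_le_one] using hxa
      · simp [hb]
    · refine ⟨-Pi.single a 1, fun b => ?_, ?_⟩
      · by_cases hb : b = a
        · subst hb; simpa [not_lt.2 zero_le_one] using hxa
        · simp [hb]
      · rw [Matrix.mulVec_neg, incidence_mulVec_single, ha, neg_sub]
  obtain ⟨c, hc, h1⟩ := exists_unit_excess _ hR h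
  refine ⟨-c, fun j hj => ?_, fun a => ⟨hx.1 a, hx.2 a, fun ha => ?_, fun ha => ?_⟩⟩
  · rw [Matrix.mulVec_neg, Pi.neg_apply, h1 j hj]
    norm_num
  · exact (hc a).2 (by simpa using ha)
  · exact (hc a).1 (by simpa using ha)

/-- Every point of the box has a representative modulo potential differences which lies on a face
exposed by a functional negative off `i`. -/
lemma exists_mem_boxFace_of_mem_Icc (hG : WeaklyConnected G) (𝓑 : IntegralCycleBasis G) (i : V)
    {l u y : Arc G → ℝ} (hy : y ∈ Set.Icc l u) :
    ∃ x c, NegativeOff i c ∧ x ∈ boxFace l u c ∧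
      𝓑.cycleMatrix.mulVec x = 𝓑.cycleMatrix.mulVec y := by
  obtain ⟨d, hd⟩ := exists_unit_excess_of_weaklyConnected hG i
  have hcont : Continuous fun x : Arc G → ℝ => 𝓑.cycleMatrix.mulVec x :=
    𝓑.cycleMatrix.mulVecLin.continuous_of_finiteDimensional
  have hcpt : IsCompact
      (Set.Icc l u ∩ {x | 𝓑.cycleMatrix.mulVec x = 𝓑.cycleMatrix.mulVec y}) :=
    isCompact_Icc.inter_right (isClosed_eq hcont continuous_const)
  have hdc : Continuous fun x : Arc G → ℝ => d ⬝ᵥ x := by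
    unfold dotProduct
    fun_prop
  -- On a fibre, `d` measures the sum of the potentials normalised at `i`, so `x` is the lowest
  -- point of the fibre.
  obtain ⟨x, ⟨hx, hxy⟩, hmin⟩ := hcpt.exists_isMinOn ⟨y, hy, rfl⟩ hdc.continuousOn
  have hreach : ∀ j, Relation.ReflTransGen (residual l u x) j i := by
    classical
    by_contra! hne
    obtain ⟨j₀, hj₀⟩ := hne
    -- Lowering the potential simultaneously at all vertices that cannot reach `i` meets no tight
    -- bound and decreases `d`, against minimality.
    let χ : V → ℝ := fun j => if Relation.ReflTransGen (residual l u x) j i then 0 else 1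
    have hχ : ∀ v w, residual l u x v w → χ v ≤ χ w := by
      intro v w h
      simp only [χ]
      by_cases hw : Relation.ReflTransGen (residual l u x) w i
      · simp [hw, Relation.ReflTransGen.head h hw]
      · rw [if_neg hw]; split_ifs <;> simp
    obtain ⟨ε, hε, hmem⟩ := exists_sub_smul_mem_Icc (g := grad G χ) hx
      (fun a ha => lt_of_le_of_ne (hx.1 a) fun h => by
        have := hχ a.1.1 a.1.2 ⟨a, Or.inl ⟨rfl, h.symm⟩⟩
        simp only [grad] at ha
        linarith)
      (fun a ha => lt_of_le_of_ne (hx.2 a) fun h => by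
        have := hχ a.1.2 a.1.1 ⟨a, Or.inr ⟨rfl, h⟩⟩
        simp only [grad] at ha
        linarith)
    have hle : d ⬝ᵥ x ≤ d ⬝ᵥ (x - ε • grad G χ) := hmin ⟨hmem, by
      rw [Set.mem_ofPred_eq, Matrix.mulVec_sub, Matrix.mulVec_smul, 𝓑.cycleMatrix_mulVec_grad,
        smul_zero, sub_zero, hxy]⟩
    have hpos : 0 < d ⬝ᵥ grad G χ := by
      have hi : χ i = 0 := if_pos Relation.ReflTransGen.refl
      have hχd : ∀ j, χ j * (incidence ℝ G).mulVec d j = χ j := fun j => by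
        by_cases hj : j = i
        · simp [hj, hi]
        · rw [hd j hj, mul_one]
      have hχ0 : ∀ j, 0 ≤ χ j := fun j => by simp only [χ]; split_ifs <;> simp
      rw [dotProduct_grad, Finset.sum_congr rfl fun j _ => hχd j]
      exact Finset.sum_pos' (fun j _ => hχ0 j) ⟨j₀, Finset.mem_univ _, by simp [hj₀]⟩
    rw [dotProduct_sub, dotProduct_smul, smul_eq_mul] at hle
    nlinarith
  obtain ⟨c, hc, hxc⟩ := exists_negativeOff_of_reachable hx hreach
  exact ⟨x, c, hc, hxc, hxy⟩

/-! ### The images of the bounded faces form a polyhedral subdivision -/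

/-- A functional that factors through the projection annihilates gradients, hence has zero excess
everywhere and may be added with any coefficient. -/
lemma NegativeOff.add_smul_of_factors (I : Instance G) (𝓑 : IntegralCycleBasis G) {i : V}
    {c e : Arc G → ℝ} (hc : NegativeOff i c) (f : (Fin (cyclomaticNumber G) → ℝ) →ₗ[ℝ] ℝ)
    (he : ∀ x, e ⬝ᵥ x = f (I.projₗ 𝓑 x)) (t : ℝ) : NegativeOff i (c + t • e) := by
  intro j hj
  have : (incidence ℝ G).mulVec e j = 0 := by
    rw [incidence_mulVec_apply, he, I.projₗ_grad, map_zero]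
  rw [Matrix.mulVec_add, Matrix.mulVec_smul, Pi.add_apply, Pi.smul_apply, this, smul_zero, add_zero]
  exact hc j hj

lemma exists_dotProduct_eq {A F : Type*} [Fintype A] [DecidableEq A] [AddCommGroup F] [Module ℝ F]
    (f : (A → ℝ) →ₗ[ℝ] F) (g : F →ₗ[ℝ] ℝ) : ∃ e : A → ℝ, ∀ x, e ⬝ᵥ x = g (f x) := by
  refine ⟨fun a => g (f (Pi.single a 1)), fun x => ?_⟩
  conv_rhs => rw [pi_eq_sum_univ' x]
  simp [dotProduct, mul_comm]

/-- The exposing functional is pulled back to arc space and added to `c` with a small positive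
factor. -/
lemma NegativeOff.exists_of_isFace_image {I : Instance G} (hlu : ∀ a, I.l a < I.u a)
    (𝓑 : IntegralCycleBasis G) {i : V} {c : Arc G → ℝ} (hc : NegativeOff i c)
    {F : Set (Fin (cyclomaticNumber G) → ℝ)} (hF : IsFace (I.projₗ 𝓑 '' boxFace I.l I.u c) F) :
    ∃ d, NegativeOff i d ∧ F = I.projₗ 𝓑 '' boxFace I.l I.u d := by
  obtain ⟨L, rfl⟩ := hF.2 hF.1
  obtain ⟨e, he⟩ := exists_dotProduct_eq (I.projₗ 𝓑) L.toLinearMap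
  obtain ⟨ε, -, h⟩ := exists_argmax_boxFace_eq (fun a => (hlu a).le) c e
  refine ⟨_, hc.add_smul_of_factors I 𝓑 L.toLinearMap he ε, ?_⟩
  rw [← h]
  ext z
  constructor
  · rintro ⟨⟨x, hx, rfl⟩, hmax⟩
    refine ⟨x, ⟨hx, fun y hy => ?_⟩, rfl⟩
    rw [he, he]
    exact hmax _ ⟨y, hy, rfl⟩
  · rintro ⟨x, ⟨hx, hmax⟩, rfl⟩
    refine ⟨⟨x, hx, rfl⟩, ?_⟩
    rintro _ ⟨y, hy, rfl⟩
    have := hmax y hy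
    rwa [he, he] at this

/-- By injectivity the intersection is the image of the common part of the two box faces. If
nonempty, this part is where `d` is maximal on the face of `c`; it remains to express `d` there
through the projection. -/
lemma NegativeOff.isFace_image_inter {I : Instance G} (𝓑 : IntegralCycleBasis G) {i : V}
    {c d : Arc G → ℝ} (hc : NegativeOff i c) (hd : NegativeOff i d)
    (hne : (I.projₗ 𝓑 '' boxFace I.l I.u c ∩ I.projₗ 𝓑 '' boxFace I.l I.u d).Nonempty) :
    IsFace (I.projₗ 𝓑 '' boxFace I.l I.u c)
      (I.projₗ 𝓑 '' boxFace I.l I.u c ∩ I.projₗ 𝓑 '' boxFace I.l I.u d) := by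
  refine ⟨hne, fun _ => ?_⟩
  have hinj : ∀ {x y}, x ∈ boxFace I.l I.u c → y ∈ boxFace I.l I.u d →
      I.projₗ 𝓑 y = I.projₗ 𝓑 x → y = x := fun hx hy h =>
    I.injOn_projₗ 𝓑 i ⟨d, hd, hy⟩ ⟨c, hc, hx⟩ h
  -- The direction space of the face of `c`. The projection is injective on it, so a linear left
  -- inverse `r` transports `d` to the target.
  let K : Submodule ℝ (Arc G → ℝ) :=
    { carrier := {y | ∀ a, c a = 0 ∨ y a = 0}
      zero_mem' := by simp
      add_mem' := fun {x y} hx hy a => by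
        rcases hx a with h | h
        · exact Or.inl h
        · exact (hy a).imp_right fun h' => by simp [h, h']
      smul_mem' := fun t x hx a => (hx a).imp_right fun h => by simp [h] }
  obtain ⟨r, hr⟩ := LinearMap.exists_leftInverse_of_injective (I.projₗ 𝓑 ∘ₗ K.subtype) (by
    refine LinearMap.ker_eq_bot'.2 fun y hy => Subtype.ext ?_
    exact hc.eq_zero_of_projₗ_eq_zero (I := I) (𝓑 := 𝓑) y.2 hy)
  let f : (Fin (cyclomaticNumber G) → ℝ) →ₗ[ℝ] ℝ := dotProductBilin ℝ ℝ d ∘ₗ K.subtype ∘ₗ r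
  have hf : ∀ y ∈ K, f (I.projₗ 𝓑 y) = d ⬝ᵥ y := fun y hy => by
    have := LinearMap.congr_fun hr ⟨y, hy⟩
    simp only [LinearMap.comp_apply, LinearMap.id_apply, Submodule.subtype_apply] at this
    simp only [f, LinearMap.comp_apply, this]
    rfl
  have hdiff : ∀ {x y}, x ∈ boxFace I.l I.u c → y ∈ boxFace I.l I.u c → x - y ∈ K := by
    intro x y hx hy a
    rcases lt_trichotomy (c a) 0 with h | h | h
    · right; simp [(hx a).2.2.2 h, (hy a).2.2.2 h]
    · exact Or.inl h
    · right; simp [(hx a).2.2.1 h, (hy a).2.2.1 h]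
  have hle : ∀ {x y}, x ∈ boxFace I.l I.u c → y ∈ boxFace I.l I.u c →
      (f (I.projₗ 𝓑 y) ≤ f (I.projₗ 𝓑 x) ↔ d ⬝ᵥ y ≤ d ⬝ᵥ x) := by
    intro x y hx hy
    have := hf _ (hdiff hx hy)
    rw [map_sub, map_sub, dotProduct_sub] at this
    constructor <;> intro h <;> linarith
  refine ⟨LinearMap.toContinuousLinearMap f, ?_⟩
  obtain ⟨_, ⟨x₀, hx₀, rfl⟩, ⟨y₀, hy₀, hxy⟩⟩ := hne
  obtain rfl := hinj hx₀ hy₀ hxy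
  ext z
  constructor
  · rintro ⟨⟨x, hx, rfl⟩, ⟨y, hy, hyx⟩⟩
    obtain rfl := hinj hx hy hyx
    refine ⟨⟨y, hx, rfl⟩, ?_⟩
    rintro _ ⟨w, hw, rfl⟩
    exact (hle hx hw).2 (isMaxOn_of_mem_boxFace hy (boxFace_subset_Icc _ _ _ hw))
  · rintro ⟨⟨x, hx, rfl⟩, hmax⟩
    refine ⟨⟨x, hx, rfl⟩, x, ?_, rfl⟩
    -- The common point `y₀` maximises `d` over the whole box, so any `x` with at least its value
    -- does too.
    have h1 := (hle hx hx₀).1 (hmax _ ⟨y₀, hx₀, rfl⟩)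
    refine mem_boxFace_of_isMaxOn ((boxFace_subset_Icc _ _ _ hx).1.trans
      (boxFace_subset_Icc _ _ _ hx).2) (boxFace_subset_Icc _ _ _ hx) fun y hy => ?_
    exact (isMaxOn_of_mem_boxFace hy₀ hy).trans h1

/-- The images of the bounded faces of `P_i`. -/
def Instance.cells (I : Instance G) (𝓑 : IntegralCycleBasis G) (i : V) :
    Set (Set (Fin (cyclomaticNumber G) → ℝ)) :=
  {C | ∃ c, NegativeOff i c ∧ C = I.projₗ 𝓑 '' boxFace I.l I.u c}

lemma Instance.image_boundedFaces (I : Instance G) (hG : WeaklyConnected G)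
    (hlu : ∀ a, I.l a < I.u a) (𝓑 : IntegralCycleBasis G) (i : V) :
    (fun F => I.proj 𝓑 '' F) '' I.boundedFaces i = I.cells 𝓑 i := by
  ext C
  constructor
  · rintro ⟨F, hF, rfl⟩
    obtain ⟨c, hc, rfl⟩ := (I.mem_boundedFaces_iff hG hlu).1 hF
    exact ⟨c, hc, rfl⟩
  · rintro ⟨c, hc, rfl⟩
    exact ⟨_, (I.mem_boundedFaces_iff hG hlu).2 ⟨c, hc, rfl⟩, rfl⟩

lemma Instance.isPolyhedralSubdivision_cells (I : Instance G) (hG : WeaklyConnected G)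
    (hlu : ∀ a, I.l a < I.u a) (𝓑 : IntegralCycleBasis G) (i : V) :
    IsPolyhedralSubdivision (I.Z 𝓑) (I.cells 𝓑 i) where
  finite := by
    refine ((finite_range_boxFace I.l I.u).image (I.projₗ 𝓑 '' ·)).subset ?_
    rintro _ ⟨c, -, rfl⟩
    exact ⟨_, ⟨c, rfl⟩, rfl⟩
  polytope := by
    rintro _ ⟨c, -, rfl⟩
    rw [image_boxFace hlu]
    exact exists_eq_convexHull_vadd_parallelepiped _ _
  face_mem := by
    rintro _ ⟨c, hc, rfl⟩ F hF
    exact hc.exists_of_isFace_image hlu 𝓑 hF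
  inter := by
    rintro _ ⟨c, hc, rfl⟩ _ ⟨d, hd, rfl⟩ hne
    refine ⟨hc.isFace_image_inter 𝓑 hd hne, ?_⟩
    rw [Set.inter_comm] at hne ⊢
    exact hd.isFace_image_inter 𝓑 hc hne
  union := by
    rw [I.Z_eq_image]
    apply Set.Subset.antisymm
    · rintro _ ⟨_, ⟨c, -, rfl⟩, x, hx, rfl⟩
      exact ⟨x, boxFace_subset_Icc _ _ _ hx, rfl⟩
    · rintro _ ⟨y, hy, rfl⟩
      obtain ⟨x, c, hc, hx, hxy⟩ := exists_mem_boxFace_of_mem_Icc hG 𝓑 i hy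
      exact ⟨_, ⟨c, hc, rfl⟩, x, hx, by simp [Instance.proj, hxy]⟩

lemma Instance.isFineZonotopalTiling_cells (I : Instance G) (hG : WeaklyConnected G)
    (hlu : ∀ a, I.l a < I.u a) (𝓑 : IntegralCycleBasis G) (i : V) :
    IsFineZonotopalTiling (I.scaledCycleMatrix 𝓑) (I.Z 𝓑) (I.cells 𝓑 i) where
  isZonotope := I.isZonotope_Z 𝓑 hlu
  subdivision := I.isPolyhedralSubdivision_cells hG hlu 𝓑 i
  cells := by
    rintro _ ⟨c, -, rfl⟩
    exact ⟨_, _, I.image_boxFace_eq_zonotope 𝓑 hlu c⟩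
  fine := by
    rintro _ ⟨⟨c, hc, rfl⟩, -⟩
    refine ⟨_, _, I.image_boxFace_eq_zonotope 𝓑 hlu c, ?_⟩
    convert hc.linearIndependent_smul hlu 𝓑 using 2 with a
    exact I.col_scaledCycleMatrix 𝓑 a.1

/-! ### Tiles -/

/-- A ratio test: the smallest `|c a / e a|` determines a step at which one coefficient becomes zero
while none has changed sign, so constraints on the face are only dropped. -/
lemma exists_add_smul_zero {A : Type*} [Fintype A] {l u c e : A → ℝ} (he : e ≠ 0)
    (h : ∀ a, c a = 0 → e a = 0) :
    ∃ t : ℝ, fixedCoords (c + t • e) ⊂ fixedCoords c ∧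
      boxFace l u c ⊆ boxFace l u (c + t • e) := by
  obtain ⟨a₀, ha₀, hmin⟩ := (fixedCoords e).exists_min_image (fun a => |c a / e a|)
    (by obtain ⟨a, ha⟩ := Function.ne_iff.1 he; exact ⟨a, mem_fixedCoords.2 ha⟩)
  rw [mem_fixedCoords] at ha₀
  set t := -(c a₀ / e a₀) with ht
  have habs : ∀ a, |t * e a| ≤ |c a| := by
    intro a
    by_cases hea : e a = 0
    · simp [hea]
    · have := hmin a (mem_fixedCoords.2 hea)
      rw [← abs_neg (c a₀ / e a₀), ← ht, abs_div, le_div_iff₀ (abs_pos.2 hea)] at this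
      rwa [abs_mul]
  have hzero : ∀ a, c a = 0 → (c + t • e) a = 0 := fun a ha => by simp [ha, h a ha]
  refine ⟨t, Finset.ssubset_iff_of_subset (fun a ha => ?_) |>.2 ⟨a₀, ?_, ?_⟩, fun x hx a => ?_⟩
  · rw [mem_fixedCoords] at ha ⊢
    exact fun h0 => ha (hzero a h0)
  · exact mem_fixedCoords.2 fun h0 => ha₀ (h a₀ h0)
  · refine notMem_fixedCoords.2 ?_
    simp only [ht, Pi.add_apply, Pi.smul_apply, smul_eq_mul]
    field_simp
    ring
  · obtain ⟨h1, h2, h3, h4⟩ := hx a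
    have hab := abs_le.1 (habs a)
    refine ⟨h1, h2, fun hpos => h3 ?_, fun hneg => h4 ?_⟩
    · by_contra hc
      rw [abs_of_nonpos (not_lt.1 hc)] at hab
      simp only [Pi.add_apply, Pi.smul_apply, smul_eq_mul] at hpos
      linarith
    · by_contra hc
      rw [abs_of_nonneg (not_lt.1 hc)] at hab
      simp only [Pi.add_apply, Pi.smul_apply, smul_eq_mul] at hneg
      linarith

lemma card_notMem_lt_of_ssubset {A : Type*} [Fintype A] {S S' : Finset A} [DecidableEq A]
    (h : S ⊂ S') : Fintype.card {a // a ∉ S'} < Fintype.card {a // a ∉ S} := by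
  have h1 := Finset.card_lt_card h
  have h2 := S'.card_le_univ
  rw [Fintype.card_subtype_compl, Fintype.card_subtype_compl, Fintype.card_coe, Fintype.card_coe]
  omega

/-- A bounded face of dimension less than `μ` lies in a larger bounded face. -/
lemma NegativeOff.exists_dim_lt {I : Instance G} (hlu : ∀ a, I.l a < I.u a)
    (𝓑 : IntegralCycleBasis G) {i : V} {c : Arc G → ℝ} (hc : NegativeOff i c)
    (hdim : dim (boxFace I.l I.u c) < cyclomaticNumber G) :
    ∃ d, NegativeOff i d ∧ boxFace I.l I.u c ⊆ boxFace I.l I.u d ∧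
      dim (boxFace I.l I.u c) < dim (boxFace I.l I.u d) := by
  -- There are fewer than `μ` free coordinates, so some nonzero combination of the cycles vanishes
  -- on all of them.
  let φ : (Fin (cyclomaticNumber G) → ℝ) →ₗ[ℝ] ({a // a ∉ fixedCoords c} → ℝ) :=
    LinearMap.funLeft ℝ ℝ Subtype.val ∘ₗ 𝓑.cycleMatrix.vecMulLinear
  have hker : LinearMap.ker φ ≠ ⊥ := LinearMap.ker_ne_bot_of_finrank_lt (by
    rw [Module.finrank_fintype_fun_eq_card, Module.finrank_fintype_fun_eq_card, Fintype.card_fin,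
      ← hc.dim_boxFace hlu 𝓑]
    exact hdim)
  obtain ⟨f, hf, hf0⟩ := (Submodule.ne_bot_iff _).1 hker
  set e := Matrix.vecMul f 𝓑.cycleMatrix with he
  have he0 : e ≠ 0 := fun h => hf0 (𝓑.vecMul_cycleMatrix_eq_zero h)
  obtain ⟨t, ht, hsub⟩ := exists_add_smul_zero (l := I.l) (u := I.u) (c := c) he0
    fun a ha => congrFun (LinearMap.mem_ker.1 hf) ⟨a, notMem_fixedCoords.2 ha⟩
  have hneg : NegativeOff i (c + t • e) :=
    -- The factor `T` cancels the `1 / T` in the projection.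
    hc.add_smul_of_factors I 𝓑 ((I.T : ℝ) • dotProductBilin ℝ ℝ f) (fun x => by
      have : (dotProductBilin ℝ ℝ f) (I.proj 𝓑 x) = f ⬝ᵥ I.proj 𝓑 x := rfl
      rw [LinearMap.smul_apply, I.coe_projₗ, this, Instance.proj, dotProduct_smul, smul_smul,
        mul_one_div_cancel I.T_ne_zero, one_smul, he, Matrix.dotProduct_mulVec]) t
  refine ⟨_, hneg, hsub, ?_⟩
  rw [hc.dim_boxFace hlu 𝓑, hneg.dim_boxFace hlu 𝓑]
  exact card_notMem_lt_of_ssubset ht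

/-- In a free coordinate of the smaller face both bounds are attained, and they differ, so the
larger face cannot fix it. -/
lemma fixedCoords_subset_of_boxFace_subset {A : Type*} [Fintype A] {l u c d : A → ℝ}
    (hlu : ∀ a, l a < u a) (h : boxFace l u c ⊆ boxFace l u d) :
    fixedCoords d ⊆ fixedCoords c := by
  intro a ha
  rw [mem_fixedCoords] at ha ⊢
  intro hca
  have h1 := h (lowVertex_mem (fun a => (hlu a).le) c) a
  have h2 := h (highVertex_mem (fun a => (hlu a).le) c) a
  simp only [lowVertex, highVertex, hca, lt_irrefl, if_false] at h1 h2
  rcases lt_or_gt_of_ne ha with hd | hd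
  · exact (hlu a).ne (h2.2.2.2 hd).symm
  · exact (hlu a).ne (h1.2.2.1 hd)

/-- A vertex of the face of `c` lies in both faces, so the fixed coordinates carry the same values.
-/
lemma boxFace_subset_of_fixedCoords_subset {A : Type*} [Fintype A] {l u c d : A → ℝ}
    (hlu : ∀ a, l a < u a) (h : boxFace l u c ⊆ boxFace l u d)
    (hS : fixedCoords c ⊆ fixedCoords d) : boxFace l u d ⊆ boxFace l u c := by
  intro x hx a
  have hv := lowVertex_mem (fun a => (hlu a).le) c
  have hxv : c a ≠ 0 → x a = lowVertex l u c a := by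
    intro hca
    have hda := mem_fixedCoords.1 (hS (mem_fixedCoords.2 hca))
    rcases lt_or_gt_of_ne hda with hd | hd
    · rw [(hx a).2.2.2 hd, (h hv a).2.2.2 hd]
    · rw [(hx a).2.2.1 hd, (h hv a).2.2.1 hd]
  exact ⟨(hx a).1, (hx a).2.1, fun hc => (hxv hc.ne').trans ((hv a).2.2.1 hc),
    fun hc => (hxv hc.ne).trans ((hv a).2.2.2 hc)⟩

/-- Inclusions of images reflect inclusions of faces, so maximality can be tested upstairs. A face
of dimension below `μ` can be enlarged; a strictly larger one has more free coordinates, and `μ`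
bounds their number. -/
lemma NegativeOff.isTile_iff {I : Instance G} (hlu : ∀ a, I.l a < I.u a)
    (𝓑 : IntegralCycleBasis G) {i : V} {c : Arc G → ℝ} (hc : NegativeOff i c) :
    IsTile (I.cells 𝓑 i) (I.projₗ 𝓑 '' boxFace I.l I.u c) ↔
      dim (boxFace I.l I.u c) = cyclomaticNumber G := by
  constructor
  · rintro ⟨-, hmax⟩
    by_contra hne
    obtain ⟨d, hd, hsub, hlt⟩ :=
      hc.exists_dim_lt hlu 𝓑 (lt_of_le_of_ne (hc.dim_boxFace_le hlu 𝓑) hne)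
    have := hd.subset_of_image_subset hc (hmax ⟨d, hd, rfl⟩ (Set.image_mono hsub))
    rw [hsub.antisymm this] at hlt
    exact lt_irrefl _ hlt
  · refine fun hdim => ⟨⟨c, hc, rfl⟩, ?_⟩
    rintro _ ⟨d, hd, rfl⟩ hle
    have hsub := hc.subset_of_image_subset hd hle
    refine Set.image_mono (boxFace_subset_of_fixedCoords_subset hlu hsub ?_)
    by_contra hS
    have hlt := card_notMem_lt_of_ssubset ⟨fixedCoords_subset_of_boxFace_subset hlu hsub, hS⟩
    rw [← hc.dim_boxFace hlu 𝓑, ← hd.dim_boxFace hlu 𝓑, hdim] at hlt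
    exact (hd.dim_boxFace_le hlu 𝓑).not_gt hlt

end PESP

end

theorem mainTheorem6 {V : Type*} [Fintype V] [DecidableEq V] (G : Digraph V)
    [DecidableRel G.Adj] (hG : PESP.WeaklyConnected G)
    (I : PESP.Instance G) (hlu : ∀ a, I.l a < I.u a)
    (𝓑 : PESP.IntegralCycleBasis G) (i : V) :
    -- every bounded face of `P_i` is a face of `X_LP`
    (∀ F ∈ I.boundedFaces i, Zono.IsFace I.XLP F) ∧
    -- its image is a parallelotope of the same dimension
    (∀ F ∈ I.boundedFaces i, Zono.IsParallelotope (Zono.dim F) (I.proj 𝓑 '' F)) ∧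
    -- distinct bounded faces have distinct images
    Set.InjOn (fun F => I.proj 𝓑 '' F) (I.boundedFaces i) ∧
    -- the images are the cells of a fine zonotopal tiling of `Z`
    Zono.IsFineZonotopalTiling (I.scaledCycleMatrix 𝓑) (I.Z 𝓑)
      ((fun F => I.proj 𝓑 '' F) '' I.boundedFaces i) ∧
    -- whose tiles are the images of the bounded faces of dimension `μ`
    (∀ C, Zono.IsTile ((fun F => I.proj 𝓑 '' F) '' I.boundedFaces i) C ↔
      ∃ F ∈ I.boundedFaces i, Zono.dim F = PESP.cyclomaticNumber G ∧ C = I.proj 𝓑 '' F) := by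
  rw [I.image_boundedFaces hG hlu 𝓑 i]
  refine ⟨fun F hF => ?_, fun F hF => ?_, fun F hF F' hF' h => ?_,
    I.isFineZonotopalTiling_cells hG hlu 𝓑 i, fun C => ⟨fun hC => ?_, ?_⟩⟩
  · obtain ⟨c, -, rfl⟩ := (I.mem_boundedFaces_iff hG hlu).1 hF
    exact I.isFace_boxFace hlu c
  · obtain ⟨c, hc, rfl⟩ := (I.mem_boundedFaces_iff hG hlu).1 hF
    exact hc.isParallelotope_image hlu 𝓑
  · obtain ⟨c, hc, rfl⟩ := (I.mem_boundedFaces_iff hG hlu).1 hF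
    obtain ⟨d, hd, rfl⟩ := (I.mem_boundedFaces_iff hG hlu).1 hF'
    exact (hc.subset_of_image_subset hd h.subset).antisymm (hd.subset_of_image_subset hc h.superset)
  · obtain ⟨c, hc, rfl⟩ := hC.1
    exact ⟨_, (I.mem_boundedFaces_iff hG hlu).2 ⟨c, hc, rfl⟩, (hc.isTile_iff hlu 𝓑).1 hC, rfl⟩
  · rintro ⟨F, hF, hdim, rfl⟩
    obtain ⟨c, hc, rfl⟩ := (I.mem_boundedFaces_iff hG hlu).1 hF
    exact (hc.isTile_iff hlu 𝓑).2 hdim
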